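/- Let $A$ be a unital $C^*$-algebra. Then $A$ has a faithful tracial state if and only if $A$ embeds unitally into a von Neumann factor of type $\mathrm{II}_1$, that is, if and only if there are a complex Hilbert space $H$, a factor $M\subseteq B(H)$ of type $\mathrm{II}_1$, and an injective unital $^*$-homomorphism $A\to M$. Here a tracial state on $A$ is a bounded linear functional $\tau\colon A\to\mathbb{C}$ with $\tau(1)=1$, $\tau(x^*x)\ge 0$ and $\tau(x^*x)=\tau(xx^*)$ for all $x\in A$; it is faithful if $\tau(x^*x)=0$ implies $x=0$. A factor is a von Neumann algebra $M\neq 0$ with centre $\mathbb{C}1$. It is of type $\mathrm{II}_1$ if it is finite (a projection $q \in M$ with $1=v^*v$, $q=vv^*$ for some $v\in M$ must equal $1$) and has no nonzero abelian projection (a projection $p\in M$ such that $pMp$ is commutative). -/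

import Mathlib

open scoped ComplexOrder

universe u

/-- A tracial state on a unital C⋆-algebra: a bounded linear functional `τ` that is a state
(positive and unital) and satisfies `τ (x⋆ x) = τ (x x⋆)`. -/
structure IsTracialState {A : Type*} [CStarAlgebra A] (τ : A →L[ℂ] ℂ) : Prop where
  nonneg : ∀ x : A, 0 ≤ τ (star x * x)
  map_one : τ 1 = 1
  trace : ∀ x : A, τ (star x * x) = τ (x * star x)

/-- A positive functional is faithful if it vanishes on no nonzero positive element `x⋆ x`. -/
def IsFaithfulFunctional {A : Type*} [CStarAlgebra A] (τ : A →L[ℂ] ℂ) : Prop :=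
  ∀ x : A, τ (star x * x) = 0 → x = 0

namespace VonNeumannAlgebra

variable {H : Type*} [NormedAddCommGroup H] [InnerProductSpace ℂ H] [CompleteSpace H]

/-- A factor: a nonzero von Neumann algebra whose centre `M ∩ M'` consists of the scalars. -/
structure IsFactor (M : VonNeumannAlgebra H) : Prop where
  one_ne_zero : (1 : H →L[ℂ] H) ≠ 0
  center : ∀ z ∈ M, z ∈ M.commutant → ∃ c : ℂ, z = c • (1 : H →L[ℂ] H)

/-- Murray-von Neumann equivalence of projections relative to `M`: `p = v⋆ v` and `q = v v⋆`
for some (partial isometry) `v` in `M`. -/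
def ProjEquiv (M : VonNeumannAlgebra H) (p q : H →L[ℂ] H) : Prop :=
  ∃ v ∈ M, star v * v = p ∧ v * star v = q

/-- `M` is finite: its identity is a finite projection, that is, `1` is not equivalent to a proper
subprojection. -/
def IsFinite (M : VonNeumannAlgebra H) : Prop :=
  ∀ q ∈ M, IsStarProjection q → M.ProjEquiv 1 q → q = 1

/-- An abelian projection of `M`: a projection `p` in `M` such that `p M p` is commutative. -/
structure IsAbelianProjection (M : VonNeumannAlgebra H) (p : H →L[ℂ] H) : Prop where
  mem : p ∈ M
  isStarProjection : IsStarProjection p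
  comm : ∀ x ∈ M, ∀ y ∈ M, Commute (p * x * p) (p * y * p)

/-- `M` is of type II₁: it is finite and has no nonzero abelian projection. -/
structure IsTypeIIOne (M : VonNeumannAlgebra H) : Prop where
  finite : M.IsFinite
  eq_zero_of_abelian : ∀ p, M.IsAbelianProjection p → p = 0

end VonNeumannAlgebra

/-! ### Functional calculus on both sides of an element. -/

section Intertwining

variable {A : Type*} [CStarAlgebra A]

/-! From embedding to trace. A finite factor `M` carries a tracial state, obtained from a vector
functional without any dimension theory. Fix `ξ ≠ 0` and compare `‖v ξ‖²` with `‖v⋆ ξ‖²` for partial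
isometries `v` in `M`. A strict inequality for one `u` forces the weak inequality for all
sub-isometries of some nonzero piece of `u`: otherwise violators could be summed by Zorn's lemma
(`exists_maximal_partialIsometry`) to one with, by finiteness, the same initial and final
projections as `u`, a contradiction. Optimizing the ratio gives, for each `κ > 1`, a projection `g`
whose corner sees the functional as tracial up to `κ` (`IsFactor.exists_projection_almost_tracial`).
The layer-cake estimates of `exists_layers` pass from partial isometries to all elements of the
corner. Finitely many projections subequivalent to `g` sum to `1` (`IsFactor.exists_finite_cover`),
which spreads the functional over `M`, and a weak-⋆ limit as `κ → 1` is a trace. The same covers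
show that nonzero projections have positive trace, so the trace is faithful and pulls back to `A`.

From trace to embedding. Restrict `τ` to the unitary group `U` of `A`; this is a positive definite
class function. On the restricted wreath product of `U` with the finitary permutations of `ℕ`, take
the infinite tensor power of `τ` on the base group and `0` elsewhere. The result is again a positive
definite class function, so left and right translations act unitarily on its GNS space; let `M` be
the commutant of the right translations. The cyclic vector is a separating trace vector, hence `M`
is finite. Any finite set can be conjugated by a block swap into coordinates that commute with it
and are independent of it (`IsMixingCharacter`). This mixing makes the conjugation-invariant vectors
scalar, so `M` is a factor, and it places noncommuting elements asymptotically centrally, which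
excludes abelian projections. As `A` is the span of `U`, represented in `M` through the zeroth
coordinate, comparing `‖·‖²` at the cyclic vector with `τ(x⋆x)` yields the injection
(`CharacterRep.exists_injective_starAlgHom`). -/

/-- The intertwining relation `x f(x⋆x) = f(xx⋆) x` for the continuous functional calculus. -/
theorem mul_cfc_star_mul_self (x : A) (f : ℝ → ℝ) (hf : Continuous f) :
    x * cfc f (star x * x) = cfc f (x * star x) * x := by
  have ha : IsSelfAdjoint (star x * x) := IsSelfAdjoint.star_mul_self x
  have hb : IsSelfAdjoint (x * star x) := IsSelfAdjoint.mul_star_self x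
  have hpoly (p : Polynomial ℝ) : x * p.aeval (star x * x) = p.aeval (x * star x) * x := by
    induction p using Polynomial.induction_on' with
    | add p q hp hq => simp [mul_add, add_mul, hp, hq]
    | monomial n r =>
      simp only [Polynomial.aeval_monomial]
      have : ∀ n : ℕ, x * (star x * x) ^ n = (x * star x) ^ n * x := fun n ↦ by
        induction n with
        | zero => simp
        | succ n ih => rw [pow_succ, ← mul_assoc, ih, pow_succ]; simp only [mul_assoc]
      rw [← mul_assoc, ← Algebra.commutes, mul_assoc, this, mul_assoc]
  -- One interval contains both spectra, so a single Weierstrass polynomial approximates `f` on both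
  -- sides of the identity already known for polynomials.
  obtain ⟨R, hR⟩ : ∃ R : ℝ, spectrum ℝ (star x * x) ∪ spectrum ℝ (x * star x) ⊆ Set.Icc (-R) R := by
    obtain ⟨R, hR⟩ := ((spectrum.isCompact (𝕜 := ℝ) (star x * x)).isBounded.union
      (spectrum.isCompact (𝕜 := ℝ) (x * star x)).isBounded).subset_closedBall 0
    exact ⟨R, hR.trans (by rw [Real.closedBall_eq_Icc]; simp)⟩
  have key (ε : ℝ) (hε : 0 < ε) :
      ‖x * cfc f (star x * x) - cfc f (x * star x) * x‖ ≤ ε * (2 * ‖x‖) := by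
    obtain ⟨p, hp⟩ := exists_polynomial_near_of_continuousOn (-R) R f hf.continuousOn ε hε
    have happrox (c : A) (hc : IsSelfAdjoint c) (hcR : spectrum ℝ c ⊆ Set.Icc (-R) R) :
        ‖cfc f c - p.aeval c‖ ≤ ε := by
      rw [← cfc_polynomial p c hc, ← cfc_sub f p.eval c]
      refine norm_cfc_le hε.le fun t ht ↦ ?_
      rw [Real.norm_eq_abs, abs_sub_comm]
      exact (hp t (hcR ht)).le
    have h1 := happrox _ ha (Set.subset_union_left.trans hR)
    have h2 := happrox _ hb (Set.subset_union_right.trans hR)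
    calc ‖x * cfc f (star x * x) - cfc f (x * star x) * x‖
        = ‖x * (cfc f (star x * x) - p.aeval (star x * x)) -
            (cfc f (x * star x) - p.aeval (x * star x)) * x‖ := by
          rw [mul_sub, sub_mul, hpoly]; congr 1; abel
      _ ≤ ‖x‖ * ε + ε * ‖x‖ := by
          refine (norm_sub_le _ _).trans (add_le_add ?_ ?_)
          · exact (norm_mul_le _ _).trans (by gcongr)
          · exact (norm_mul_le _ _).trans (by gcongr)
      _ = ε * (2 * ‖x‖) := by ring
  rw [← sub_eq_zero, ← norm_le_zero_iff]
  refine le_of_forall_pos_le_add fun δ hδ ↦ ?_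
  have h := key (δ / (2 * ‖x‖ + 1)) (by positivity)
  refine h.trans ?_
  rw [zero_add, div_mul_eq_mul_div, div_le_iff₀ (by positivity)]
  nlinarith [norm_nonneg x]

end Intertwining

/-! ### Operators determined by Gram matrices. -/

section Hilbert

variable {H : Type*} [NormedAddCommGroup H] [InnerProductSpace ℂ H] [CompleteSpace H]

local notation "⟪" x ", " y "⟫" => inner ℂ x y

/-- Two families of vectors with the same Gram matrix are related by an operator that is
isometric on the closed span of the first family and vanishes on its orthogonal complement. -/
theorem exists_partial_isometry_of_gram_eq {X : Type*} {v w : X → H}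
    (h : ∀ x y, ⟪v x, v y⟫ = ⟪w x, w y⟫) :
    ∃ V : H →L[ℂ] H, (∀ x, V (v x) = w x) ∧
      star V * V = (Submodule.span ℂ (Set.range v)).topologicalClosure.starProjection := by
  set S := Submodule.span ℂ (Set.range v) with hS
  set K := S.topologicalClosure with hK
  have hlc (f g : X →₀ ℂ) : ⟪Finsupp.linearCombination ℂ v f, Finsupp.linearCombination ℂ v g⟫ =
      ⟪Finsupp.linearCombination ℂ w f, Finsupp.linearCombination ℂ w g⟫ := by
    simp only [Finsupp.linearCombination_apply, Finsupp.sum_inner, Finsupp.inner_sum,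
      inner_smul_left, inner_smul_right, h]
  have hmem (s : S) : ∃ f : X →₀ ℂ, Finsupp.linearCombination ℂ v f = s :=
    (Finsupp.mem_span_range_iff_exists_finsupp).1 s.2
  have hnorm (f : X →₀ ℂ) :
      ‖Finsupp.linearCombination ℂ v f‖ = ‖Finsupp.linearCombination ℂ w f‖ := by
    rw [@norm_eq_sqrt_re_inner ℂ, @norm_eq_sqrt_re_inner ℂ, hlc]
  -- Coefficients are chosen arbitrarily; `hker` shows that the image does not depend on the choice,
  -- because equal Gram matrices give equal norms of combinations.
  choose F hF using hmem
  have hker (f g : X →₀ ℂ) (hfg : Finsupp.linearCombination ℂ v f = Finsupp.linearCombination ℂ v g) :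
      Finsupp.linearCombination ℂ w f = Finsupp.linearCombination ℂ w g := by
    rw [← sub_eq_zero, ← map_sub, ← norm_eq_zero, ← hnorm, map_sub, hfg, sub_self, norm_zero]
  let L : S →ₗᵢ[ℂ] H :=
    { toFun s := Finsupp.linearCombination ℂ w (F s)
      map_add' s t := by
        rw [← map_add]; apply hker; rw [map_add, hF, hF, hF]; rfl
      map_smul' c s := by
        rw [RingHom.id_apply, ← map_smul]; apply hker; rw [map_smul, hF, hF]; rfl
      norm_map' s := by
        change ‖Finsupp.linearCombination ℂ w (F s)‖ = _
        rw [← hnorm, hF]; rfl }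
  have hLi (s t : S) : ⟪L s, L t⟫ = ⟪(s : H), (t : H)⟫ := L.inner_map_map s t
  let e : S →L[ℂ] K := (Submodule.inclusion S.le_topologicalClosure).mkContinuous 1
    (fun s ↦ by rw [one_mul]; rfl)
  have he : ∀ s, (e s : H) = s := fun s ↦ rfl
  have hei : Isometry e := AddMonoidHomClass.isometry_of_norm e fun s ↦ rfl
  have hed : DenseRange e := by
    intro k
    have hk : (k : H) ∈ closure (S : Set H) := k.2
    rw [Metric.mem_closure_iff] at hk ⊢
    intro ε hε
    obtain ⟨s, hs, hd⟩ := hk ε hε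
    exact ⟨e ⟨s, hs⟩, ⟨_, rfl⟩, hd⟩
  let E : K →L[ℂ] H := L.toContinuousLinearMap.extend e
  have hE (s : S) : E (e s) = L s :=
    ContinuousLinearMap.extend_eq _ hed hei.isUniformInducing s
  have hEi (s t : K) : ⟪E s, E t⟫ = ⟪(s : H), (t : H)⟫ := by
    refine hed.induction_on₂ (p := fun s t ↦ ⟪E s, E t⟫ = ⟪(s : H), (t : H)⟫) ?_ ?_ s t
    · exact isClosed_eq (by fun_prop) (by fun_prop)
    · intro a b; rw [hE, hE, hLi, he, he]
  refine ⟨E ∘L K.orthogonalProjectionOnto, fun x ↦ ?_, ?_⟩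
  · have hx : v x ∈ S := Submodule.subset_span ⟨x, rfl⟩
    have : K.orthogonalProjectionOnto (v x) = e ⟨v x, hx⟩ :=
      Submodule.orthogonalProjectionOnto_mem_subspace_eq_self (e ⟨v x, hx⟩)
    rw [ContinuousLinearMap.comp_apply, this, hE]
    change Finsupp.linearCombination ℂ w (F ⟨v x, hx⟩) = w x
    rw [hker _ (Finsupp.single x 1) (by rw [hF]; simp)]
    simp
  · ext ξ
    refine ext_inner_left ℂ fun η ↦ ?_
    change ⟪η, star (E ∘L K.orthogonalProjectionOnto) ((E ∘L K.orthogonalProjectionOnto) ξ)⟫ = _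
    rw [ContinuousLinearMap.star_eq_adjoint, ContinuousLinearMap.adjoint_inner_right,
      ContinuousLinearMap.comp_apply, ContinuousLinearMap.comp_apply, hEi]
    change ⟪K.starProjection η, K.starProjection ξ⟫ = _
    rw [Submodule.inner_starProjection_left_eq_right]
    congr 1
    exact Submodule.starProjection_eq_self_iff.2 (Submodule.starProjection_apply_mem K ξ)

end Hilbert

/-! ### Algebra of partial isometries. -/

/-- An element `v` of a star semigroup is a partial isometry if `v v⋆ v = v`. -/
def IsPartialIsometry {R : Type*} [Mul R] [Star R] (v : R) : Prop := v * star v * v = v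

namespace IsPartialIsometry

section Monoid

variable {R : Type*} [Semigroup R] [StarMul R] {v w : R}

theorem eq (hv : IsPartialIsometry v) : v * (star v * v) = v := by rw [← mul_assoc]; exact hv

theorem star (hv : IsPartialIsometry v) : IsPartialIsometry (star v) := by
  have := congrArg Star.star hv
  simpa [IsPartialIsometry, mul_assoc] using this

theorem star_eq (hv : IsPartialIsometry v) : Star.star v * (v * Star.star v) = Star.star v := by
  simpa using hv.star.eq

theorem isStarProjection (hv : IsPartialIsometry v) : IsStarProjection (Star.star v * v) where
  isIdempotentElem := by rw [IsIdempotentElem, mul_assoc, hv.eq]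
  isSelfAdjoint := IsSelfAdjoint.star_mul_self v

theorem isStarProjection' (hv : IsPartialIsometry v) : IsStarProjection (v * Star.star v) := by
  simpa using hv.star.isStarProjection

theorem _root_.IsStarProjection.isPartialIsometry_mul {p : R} (hp : IsStarProjection p)
    (h : Star.star v * v * p = p) : IsPartialIsometry (v * p) := by
  rw [IsPartialIsometry, star_mul, hp.isSelfAdjoint.star_eq]
  calc v * p * (p * Star.star v) * (v * p) = v * (p * p) * (Star.star v * v * p) := by
        simp only [mul_assoc]
    _ = v * p := by rw [h, hp.isIdempotentElem.eq, mul_assoc, hp.isIdempotentElem.eq]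

end Monoid

end IsPartialIsometry

theorem IsStarProjection.isPartialIsometry {R : Type*} [Semigroup R] [StarMul R] {p : R}
    (hp : IsStarProjection p) : IsPartialIsometry p := by
  rw [IsPartialIsometry, hp.isSelfAdjoint.star_eq, hp.isIdempotentElem.eq, hp.isIdempotentElem.eq]

theorem IsStarProjection.star_mul_self {R : Type*} [Semigroup R] [StarMul R] {p : R}
    (hp : IsStarProjection p) : star p * p = p := by
  rw [hp.isSelfAdjoint.star_eq, hp.isIdempotentElem.eq]

/-! ### Polar decomposition inside a von Neumann algebra. -/

section Hilbert

variable {H : Type*} [NormedAddCommGroup H] [InnerProductSpace ℂ H] [CompleteSpace H]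

local notation "⟪" x ", " y "⟫" => inner ℂ x y

namespace ContinuousLinearMap

theorem inner_star_right (a : H →L[ℂ] H) (x y : H) : ⟪x, star a y⟫ = ⟪a x, y⟫ := by
  rw [star_eq_adjoint, adjoint_inner_right]

theorem inner_star_mul_self (a : H →L[ℂ] H) (x : H) : ⟪x, (star a * a) x⟫ = (‖a x‖ : ℂ) ^ 2 := by
  change ⟪x, star a (a x)⟫ = _
  rw [inner_star_right, inner_self_eq_norm_sq_to_K]; rfl

theorem re_inner_star_mul_self (a : H →L[ℂ] H) (x : H) :
    (⟪x, (star a * a) x⟫).re = ‖a x‖ ^ 2 := by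
  rw [inner_star_mul_self]; norm_cast

theorem star_mul_self_apply_eq_zero {a : H →L[ℂ] H} {x : H} :
    (star a * a) x = 0 ↔ a x = 0 := by
  refine ⟨fun h ↦ ?_, fun h ↦ ?_⟩
  · have := re_inner_star_mul_self a x
    rw [h, inner_zero_right] at this
    simpa using this.symm
  · change star a (a x) = 0
    rw [h, map_zero]

end ContinuousLinearMap

open ContinuousLinearMap

/-- With `p = v⋆v`, the product `(vp - v)⋆(vp - v)` is a combination of powers of `p` that cancels
when `p` is idempotent; the C⋆-identity then gives `vp = v`. -/
theorem isPartialIsometry_of_isStarProjection {v : H →L[ℂ] H} (h : IsStarProjection (star v * v)) :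
    IsPartialIsometry v := by
  have h1 : star (v * (star v * v) - v) * (v * (star v * v) - v) = 0 := by
    set p := star v * v with hp
    have : star (v * p - v) * (v * p - v) = p * p * p - p * p - p * p + p := by
      rw [star_sub, star_mul, h.isSelfAdjoint.star_eq, sub_mul, mul_sub, mul_sub]
      simp only [hp, mul_assoc]; abel
    rw [this]; simp [h.isIdempotentElem.eq]
  rw [CStarRing.star_mul_self_eq_zero_iff, sub_eq_zero] at h1
  rw [IsPartialIsometry, mul_assoc, h1]

namespace VonNeumannAlgebra

variable {M : VonNeumannAlgebra H}

theorem mem_of_commutes {x : H →L[ℂ] H} (h : ∀ T ∈ M.commutant, T * x = x * T) : x ∈ M := by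
  rw [← commutant_commutant M, mem_commutant_iff]; exact h

theorem commutes_of_mem {x T : H →L[ℂ] H} (hx : x ∈ M) (hT : T ∈ M.commutant) :
    T * x = x * T := ((mem_commutant_iff.1 hT) x hx).symm

theorem cfc_mem {a : H →L[ℂ] H} (ha : a ∈ M) (f : ℝ → ℝ) : cfc f a ∈ M := by
  refine mem_of_commutes fun T hT ↦ ?_
  have h : Commute a T := (commutes_of_mem ha hT).symm
  exact (h.cfc_real f).eq.symm

theorem smul_mem (c : ℂ) {a : H →L[ℂ] H} (ha : a ∈ M) : c • a ∈ M :=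
  M.toStarSubalgebra.smul_mem ha c

/-- Polar decomposition of an element of a von Neumann algebra. -/
theorem exists_polar {y : H →L[ℂ] H} (hy : y ∈ M) :
    ∃ v ∈ M, IsPartialIsometry v ∧ (∀ η, y η = 0 → v η = 0) ∧
      (∀ η, star y η = 0 → star v η = 0) ∧ y * (star v * v) = y ∧ v * star v * y = y := by
  set a := cfc Real.sqrt (star y * y) with ha
  have hpos : 0 ≤ star y * y := star_mul_self_nonneg y
  have hasa : IsSelfAdjoint a := cfc_predicate _ _
  have haa : star a * a = star y * y := by
    rw [hasa.star_eq, ha, ← cfc_mul ..]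
    conv_rhs => rw [← cfc_id' ℝ (star y * y)]
    refine cfc_congr fun t ht ↦ ?_
    exact Real.mul_self_sqrt (spectrum_nonneg_of_nonneg hpos ht)
  have hker (ζ : H) : a ζ = 0 ↔ y ζ = 0 := by
    rw [← star_mul_self_apply_eq_zero, haa, star_mul_self_apply_eq_zero]
  have hgram (ξ η : H) : ⟪a ξ, a η⟫ = ⟪y ξ, y η⟫ := by
    rw [← inner_star_right, ← inner_star_right]
    change ⟪ξ, (star a * a) η⟫ = ⟪ξ, (star y * y) η⟫
    rw [haa]
  -- Here `a = |y|`, so the families `a ξ` and `y ξ` have the same Gram matrix.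
  obtain ⟨V, hV, hP⟩ := exists_partial_isometry_of_gram_eq hgram
  set K := (Submodule.span ℂ (Set.range a)).topologicalClosure
  have hPI : IsPartialIsometry V := isPartialIsometry_of_isStarProjection (by
    rw [hP]; exact isStarProjection_starProjection)
  have hVa : V * a = y := by ext ξ; exact hV ξ
  have hVker (ζ : H) : V ζ = 0 ↔ y ζ = 0 := by
    rw [← star_mul_self_apply_eq_zero, hP, Submodule.starProjection_apply_eq_zero_iff, ← hker]
    constructor
    · intro h
      refine ext_inner_left ℂ fun η ↦ ?_
      rw [inner_zero_right, ← hasa.star_eq, inner_star_right]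
      exact h _ (Submodule.le_topologicalClosure _ (Submodule.subset_span ⟨η, rfl⟩))
    · intro h
      rw [Submodule.orthogonal_closure, Submodule.mem_orthogonal]
      intro u hu
      refine Submodule.span_induction ?_ ?_ ?_ ?_ hu
      · rintro _ ⟨η, rfl⟩
        rw [← inner_star_right, hasa.star_eq, h, inner_zero_right]
      · simp
      · intro x y _ _ hx hy; rw [inner_add_left, hx, hy, add_zero]
      · intro c x _ hx; rw [inner_smul_left, hx, mul_zero]
  have hyP : y * (star V * V) = y := by
    ext ξ
    rw [← sub_eq_zero]
    change y ((star V * V) ξ) - y ξ = 0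
    rw [← map_sub, ← hVker, map_sub]
    change (V * (star V * V)) ξ - V ξ = 0
    rw [hPI.eq, sub_self]
  refine ⟨V, mem_of_commutes fun T hT ↦ ?_, hPI, fun η ↦ (hVker η).2, fun η hη ↦ ?_, hyP, ?_⟩
  -- Membership by the bicommutant: `T` in the commutant commutes with `V` on the closed range `K`
  -- of `a`, and on the complement because `T` preserves `ker y = ker V`.
  · have hTy := commutes_of_mem hy hT
    have hTa : T * a = a * T := commutes_of_mem (cfc_mem (mul_mem (star_mem hy) hy) _) hT
    have h1 : K ≤ (T * V - V * T).ker := by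
      refine Submodule.topologicalClosure_minimal _ (Submodule.span_le.2 ?_)
        (ContinuousLinearMap.isClosed_ker _)
      rintro _ ⟨ξ, rfl⟩
      change (T * (V * a) - V * (T * a)) ξ = 0
      rw [hTa, ← mul_assoc V, hVa, hTy, sub_self]; rfl
    rw [← sub_eq_zero]
    ext ξ
    have h2 : ξ = (star V * V) ξ + (ξ - (star V * V) ξ) := by abel
    have h3 : (T * V - V * T) ((star V * V) ξ) = 0 := by
      refine h1 ?_
      rw [hP]; exact Submodule.starProjection_apply_mem K ξ
    set ζ := ξ - (star V * V) ξ with hζ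
    have h4 : V ζ = 0 := by
      rw [hζ, map_sub]
      change V ξ - (V * (star V * V)) ξ = 0
      rw [hPI.eq, sub_self]
    have h5 : V (T ζ) = 0 := by
      rw [hVker]
      change (y * T) ζ = 0
      rw [← hTy]
      change T (y ζ) = 0
      rw [(hVker ζ).1 h4, map_zero]
    rw [h2, map_add, h3, zero_add]
    change T (V ζ) - V (T ζ) = 0
    rw [h4, h5, map_zero, sub_zero]
  · have h1 : a (star V η) = 0 := by
      rw [← hη, ← hVa, star_mul, hasa.star_eq]; rfl
    have h2 : V (star V η) = 0 := by rw [hVker, ← hker, h1]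
    rw [← hPI.star_eq]
    change star V (V (star V η)) = 0
    rw [h2, map_zero]
  · rw [← hVa, ← mul_assoc]; congr 1

end VonNeumannAlgebra

end Hilbert

/-! ### Layer-cake decomposition of `x⋆x` and `xx⋆`. -/

section Layers

variable {H : Type*} [NormedAddCommGroup H] [InnerProductSpace ℂ H] [CompleteSpace H]

local notation "⟪" x ", " y "⟫" => inner ℂ x y

open ContinuousLinearMap

/-- Compress `h ≤ c • 1` by `p`; this leaves `h` unchanged. -/
theorem IsStarProjection.le_smul_of_mul_eq {h p : H →L[ℂ] H} {c : ℝ} (hp : IsStarProjection p)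
    (hh : 0 ≤ h) (hc : h ≤ c • 1) (hhp : h * p = h) : h ≤ c • p := by
  have h1 := star_left_conjugate_le_conjugate hc p
  have h2 : p * h = h := by
    have := congrArg star hhp
    rwa [star_mul, hp.isSelfAdjoint.star_eq, (IsSelfAdjoint.of_nonneg hh).star_eq] at this
  rw [hp.isSelfAdjoint.star_eq] at h1
  rwa [h2, hhp, mul_smul_comm, smul_mul_assoc, mul_one, hp.isIdempotentElem.eq] at h1

/-- The compression of `h` by `1 - p` is positive and equals `h - c • p`. -/
theorem IsStarProjection.smul_le_of_mul_eq {h p : H →L[ℂ] H} {c : ℝ} (hp : IsStarProjection p)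
    (hh : 0 ≤ h) (hhp : p * h = c • p) : c • p ≤ h := by
  have h1 := star_left_conjugate_nonneg hh (1 - p)
  have h2 : h * p = c • p := by
    have := congrArg star hhp
    rwa [star_mul, star_smul, hp.isSelfAdjoint.star_eq, (IsSelfAdjoint.of_nonneg hh).star_eq,
      star_trivial] at this
  rw [hp.one_sub.isSelfAdjoint.star_eq] at h1
  have h3 : (1 - p) * h * (1 - p) = h - c • p := by
    rw [sub_mul, one_mul, hhp, mul_sub, mul_one, sub_mul, h2, smul_mul_assoc,
      hp.isIdempotentElem.eq, sub_self, sub_zero]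
  rw [h3] at h1
  exact sub_nonneg.1 h1

/-- The slice of height `c` above level `s` of the identity function. -/
def slice (s c t : ℝ) : ℝ := min t (s + c) - min t s

theorem continuous_slice (s c : ℝ) : Continuous (slice s c) := by unfold slice; fun_prop

theorem slice_nonneg {c : ℝ} (hc : 0 ≤ c) (s t : ℝ) : 0 ≤ slice s c t := by
  unfold slice; rw [sub_nonneg]; exact min_le_min le_rfl (by linarith)

theorem slice_le {c : ℝ} (hc : 0 ≤ c) (s t : ℝ) : slice s c t ≤ c := by
  unfold slice; rcases min_cases t (s + c) with h | h <;> rcases min_cases t s with h' | h' <;> linarith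

theorem slice_le_cut {s c : ℝ} (hc : 0 ≤ c) (t : ℝ) : slice s c t ≤ max (t - s) 0 := by
  unfold slice
  rcases min_cases t (s + c) with h | h <;> rcases min_cases t s with h' | h' <;>
    rcases max_cases (t - s) 0 with h'' | h'' <;> linarith

theorem slice_le_self {s c t : ℝ} (hs : 0 ≤ s) (ht : 0 ≤ t) : slice s c t ≤ t := by
  have := le_min ht hs
  unfold slice; linarith [min_le_left t (s + c)]

theorem sum_slice {n : ℕ} (hn : 0 < n) {t : ℝ} (h0 : 0 ≤ t) (h1 : t ≤ 1) :
    ∑ k ∈ Finset.range n, slice (k / n) (n : ℝ)⁻¹ t = t := by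
  have h (k : ℕ) : slice (k / n) (n : ℝ)⁻¹ t = min t ((k + 1 : ℕ) / n) - min t (k / n) := by
    unfold slice; congr 2; push_cast; ring
  simp_rw [h]
  rw [Finset.sum_range_sub (fun k : ℕ ↦ min t ((k : ℝ) / n))]
  have : (n : ℝ) ≠ 0 := by positivity
  simp [div_self this, h0, h1]

variable {x v : H →L[ℂ] H} {s c : ℝ}

theorem star_cfc_cut (x : H →L[ℂ] H) (s : ℝ) :
    star (cfc (fun t : ℝ ↦ max (t - s) 0) (star x * x)) =
      cfc (fun t : ℝ ↦ max (t - s) 0) (star x * x) :=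
  (cfc_predicate (R := ℝ) (p := IsSelfAdjoint) _ _ : IsSelfAdjoint _).star_eq

/-- The slice vanishes at and below level `s`, so it is carried by the support of `x (x⋆x - s)₊`,
which `hy` places under `v⋆v`; its height is at most `c`. -/
theorem cfc_slice_le_smul (hs : 0 ≤ s) (hc : 0 ≤ c) (hc1 : c ≤ 1) (hv : IsPartialIsometry v)
    (hy : x * cfc (fun t : ℝ ↦ max (t - s) 0) (star x * x) * (star v * v) =
      x * cfc (fun t : ℝ ↦ max (t - s) 0) (star x * x)) :
    cfc (slice s c) (star x * x) ≤ c • (star v * v) := by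
  have hpos : 0 ≤ star x * x := star_mul_self_nonneg x
  have hsp : ∀ t ∈ spectrum ℝ (star x * x), 0 ≤ t := fun t ht ↦ spectrum_nonneg_of_nonneg hpos ht
  have hasa : IsSelfAdjoint (star x * x) := IsSelfAdjoint.star_mul_self x
  set a := star x * x with ha
  set f : ℝ → ℝ := fun t ↦ max (t - s) 0 with hf
  have hfc : Continuous f := by fun_prop
  have hh := continuous_slice s c
  have hh0 : 0 ≤ cfc (slice s c) a := cfc_nonneg fun t _ ↦ slice_nonneg hc s t
  refine hv.isStarProjection.le_smul_of_mul_eq hh0 ?_ ?_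
  · calc cfc (slice s c) a ≤ cfc (fun _ ↦ c) a := cfc_mono fun t _ ↦ slice_le hc s t
      _ = c • 1 := by rw [cfc_const c a, Algebra.algebraMap_eq_smul_one]
  · have key (η : H) (hη : (x * cfc f a) η = 0) : cfc (slice s c) a η = 0 := by
      have h1 : star (x * cfc f a) * (x * cfc f a) = cfc (fun t ↦ f t * t * f t) a := by
        rw [star_mul, star_cfc_cut, cfc_mul (fun t ↦ f t * t) f a, cfc_mul f (fun t ↦ t) a,
          cfc_id' ℝ a, ha]
        simp only [mul_assoc, hf]
      -- The fourth power of the slice is at most `f t * t * f t`: two factors are bounded by `f t`,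
      -- one by `t`, and the last by `1` since `c ≤ 1`.
      have h2 : star (cfc (slice s c) a * cfc (slice s c) a) *
          (cfc (slice s c) a * cfc (slice s c) a) ≤
          star (x * cfc f a) * (x * cfc f a) := by
        rw [h1, star_mul, (IsSelfAdjoint.of_nonneg hh0).star_eq,
          ← cfc_mul (slice s c) (slice s c) a, ← cfc_mul ..]
        refine cfc_mono fun t ht ↦ ?_
        have a0 := slice_nonneg hc s t
        have a1 := slice_le hc s t
        have a2 : slice s c t ≤ f t := slice_le_cut hc t
        have a3 := slice_le_self (c := c) hs (hsp t ht)
        have a4 := a1.trans hc1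
        calc slice s c t * slice s c t * (slice s c t * slice s c t)
            ≤ f t * t * (f t * 1) := by
              have := hsp t ht
              have := a0.trans a2
              gcongr
          _ = f t * t * f t := by ring
      have h3 : 0 ≤ (⟪η, _⟫).re := ((le_def _ _).1 h2).re_inner_nonneg_right η
      rw [sub_apply, inner_sub_right, Complex.sub_re, re_inner_star_mul_self,
        re_inner_star_mul_self, hη, norm_zero] at h3
      have h4 : ((cfc (slice s c) a * cfc (slice s c) a) η) = 0 := by
        rw [← norm_eq_zero]
        nlinarith [norm_nonneg ((cfc (slice s c) a * cfc (slice s c) a) η)]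
      have h5 : (star (cfc (slice s c) a) * cfc (slice s c) a) η = 0 := by
        rw [(IsSelfAdjoint.of_nonneg hh0).star_eq, h4]
      exact star_mul_self_apply_eq_zero.1 h5
    ext ξ
    rw [← sub_eq_zero]
    change cfc (slice s c) a ((star v * v) ξ) - cfc (slice s c) a ξ = 0
    rw [← map_sub]
    apply key
    rw [map_sub, sub_eq_zero]
    exact congrArg (fun T : H →L[ℂ] H ↦ T ξ) hy

/-- Above level `s + c` the slice is constantly `c`, so `c - slice` is annihilated by the part of
`x` above that level, hence by `v`. -/
theorem smul_le_cfc_slice (hc : 0 ≤ c)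
    (hker : ∀ η, (x * cfc (fun t : ℝ ↦ max (t - (s + c)) 0) (star x * x)) η = 0 → v η = 0)
    (hv : IsPartialIsometry v) : c • (star v * v) ≤ cfc (slice s c) (star x * x) := by
  have hasa : IsSelfAdjoint (star x * x) := IsSelfAdjoint.star_mul_self x
  set a := star x * x with ha
  set f : ℝ → ℝ := fun t ↦ max (t - (s + c)) 0 with hf
  have hfc : Continuous f := by fun_prop
  have hh := continuous_slice s c
  refine hv.isStarProjection.smul_le_of_mul_eq (cfc_nonneg fun t _ ↦ slice_nonneg hc s t) ?_
  have h1 : x * cfc f a * (c • 1 - cfc (slice s c) a) = 0 := by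
    have : cfc f a * (c • 1 - cfc (slice s c) a) = 0 := by
      rw [← Algebra.algebraMap_eq_smul_one, ← cfc_const c a, ← cfc_sub .., ← cfc_mul ..]
      rw [← cfc_zero ℝ a]
      refine cfc_congr fun t _ ↦ ?_
      simp only [hf, slice, Pi.zero_apply]
      rcases le_total t (s + c) with h | h
      · rw [max_eq_right (by linarith), zero_mul]
      · rw [min_eq_right h, min_eq_right (by linarith)]; ring
    rw [mul_assoc, this, mul_zero]
  have h2 : v * (c • 1 - cfc (slice s c) a) = 0 := by
    ext ξ
    exact hker _ (congrArg (fun T : H →L[ℂ] H ↦ T ξ) h1)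
  rw [mul_sub, mul_smul_comm, mul_one, sub_eq_zero] at h2
  rw [mul_assoc, ← h2, mul_smul_comm]

theorem cfc_sum_slice {a : H →L[ℂ] H} (ha0 : 0 ≤ a) (ha1 : a ≤ 1) {n : ℕ} (hn : 0 < n) :
    ∑ k ∈ Finset.range n, cfc (slice (k / n) (n : ℝ)⁻¹) a = a := by
  have hsa := IsSelfAdjoint.of_nonneg ha0
  rw [← cfc_sum (a := a) (fun k : ℕ ↦ slice (k / n) (n : ℝ)⁻¹) _
    fun k _ ↦ (continuous_slice _ _).continuousOn]
  conv_rhs => rw [← cfc_id' ℝ a]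
  refine cfc_congr fun t ht ↦ ?_
  simp only [Finset.sum_apply]
  refine sum_slice hn (spectrum_nonneg_of_nonneg ha0 ht) ?_
  have := (le_algebraMap_iff_spectrum_le (r := (1 : ℝ)) (a := a)).1 (by simpa using ha1)
  exact this t ht

theorem star_mul_self_le_one (hx : ‖x‖ ≤ 1) : star x * x ≤ 1 := by
  rw [← CStarAlgebra.norm_le_one_iff_of_nonneg _ (star_mul_self_nonneg x), CStarRing.norm_star_mul_self]
  nlinarith [norm_nonneg x]

namespace VonNeumannAlgebra

variable {M : VonNeumannAlgebra H}

/-- Layer-cake estimates for `x⋆x` and `xx⋆` by projections that are equivalent level by level. -/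
theorem exists_layers (hx : x ∈ M) (hx1 : ‖x‖ ≤ 1) {g : H →L[ℂ] H}
    (hg : IsStarProjection g) (hxg : x * g = x) (hgx : g * x = x) {n : ℕ} (hn : 0 < n) :
    ∃ v : ℕ → H →L[ℂ] H,
      (∀ k, v k ∈ M ∧ IsPartialIsometry (v k) ∧ v k * g = v k ∧ g * v k = v k) ∧
      star x * x ≤ (n : ℝ)⁻¹ • ∑ k ∈ Finset.range n, star (v k) * v k ∧
      (n : ℝ)⁻¹ • ∑ k ∈ Finset.range n, star (v (k + 1)) * v (k + 1) ≤ star x * x ∧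
      (n : ℝ)⁻¹ • ∑ k ∈ Finset.range n, v (k + 1) * star (v (k + 1)) ≤ x * star x := by
  -- `v k` is the polar part of `x` cut at level `k / n`. The upper bound uses levels `0, …, n - 1`
  -- and the lower bounds `1, …, n`, so the two differ by only two terms of weight `1 / n`.
  let F : ℕ → H →L[ℂ] H := fun k ↦ cfc (fun t : ℝ ↦ max (t - k / n) 0) (star x * x)
  have hFM (k : ℕ) : F k ∈ M := cfc_mem (mul_mem (star_mem hx) hx) _
  choose v hvM hv hker hker' hyv hvy using fun k ↦ exists_polar (mul_mem hx (hFM k))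
  have hn0 : (0 : ℝ) ≤ (n : ℝ)⁻¹ := by positivity
  have hn1 : (n : ℝ)⁻¹ ≤ 1 := inv_le_one_of_one_le₀ (by exact_mod_cast hn)
  have hsucc (k : ℕ) : ((k + 1 : ℕ) : ℝ) / n = k / n + (n : ℝ)⁻¹ := by push_cast; ring
  have hsx : star x * g = star x := by
    have := congrArg star hgx
    rwa [star_mul, hg.isSelfAdjoint.star_eq] at this
  have hgsx : g * star x = star x := by
    have := congrArg star hxg
    rwa [star_mul, hg.isSelfAdjoint.star_eq] at this
  have hcomm (k : ℕ) : F k * g = g * F k := by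
    have : Commute (star x * x) g := by
      rw [Commute, SemiconjBy, mul_assoc, hxg, ← mul_assoc, hgsx]
    exact (this.cfc_real _).eq
  -- By the intertwining relation the adjoint of a cut of `x` is the same cut of `star x`, so the
  -- adjoints of the `v k` serve as the layers of `x * star x`.
  have hstar (k : ℕ) : star (x * F k) =
      star x * cfc (fun t : ℝ ↦ max (t - k / n) 0) (star (star x) * star x) := by
    have h1 : x * F k = cfc (fun t : ℝ ↦ max (t - k / n) 0) (x * star x) * x :=
      mul_cfc_star_mul_self x _ (by fun_prop)
    have h2 := star_cfc_cut (star x) (k / n)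
    rw [star_star] at h2 ⊢
    rw [h1, star_mul, h2]
  have hx1' : ‖star x‖ ≤ 1 := by rwa [norm_star]
  refine ⟨v, fun k ↦ ⟨hvM k, hv k, ?_, ?_⟩, ?_, ?_, ?_⟩
  · have : v k * (1 - g) = 0 := by
      ext ξ
      refine hker k _ ?_
      change (x * F k * (1 - g)) ξ = 0
      rw [mul_sub, mul_one, mul_assoc, hcomm, ← mul_assoc, hxg, sub_self]; rfl
    rw [mul_sub, mul_one, sub_eq_zero] at this
    exact this.symm
  · have : star (v k) * (1 - g) = 0 := by
      ext ξ
      refine hker' k _ ?_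
      change (star (x * F k) * (1 - g)) ξ = 0
      rw [mul_sub, mul_one, star_mul, mul_assoc, hsx, sub_self]; rfl
    rw [mul_sub, mul_one, sub_eq_zero] at this
    have h := congrArg star this
    rw [star_mul, star_star, hg.isSelfAdjoint.star_eq] at h
    exact h.symm
  · rw [Finset.smul_sum]
    conv_lhs => rw [← cfc_sum_slice (star_mul_self_nonneg x) (star_mul_self_le_one hx1) hn]
    exact Finset.sum_le_sum fun k _ ↦
      cfc_slice_le_smul (by positivity) hn0 hn1 (hv k) (hyv k)
  · rw [Finset.smul_sum]
    conv_rhs => rw [← cfc_sum_slice (star_mul_self_nonneg x) (star_mul_self_le_one hx1) hn]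
    refine Finset.sum_le_sum fun k _ ↦ smul_le_cfc_slice hn0 ?_ (hv (k + 1))
    rw [← hsucc]; exact hker (k + 1)
  · rw [Finset.smul_sum]
    have h0 := star_mul_self_nonneg (star x)
    have h1 := star_mul_self_le_one hx1'
    have hsum := cfc_sum_slice h0 h1 hn
    rw [star_star] at hsum
    conv_rhs => rw [← hsum]
    refine Finset.sum_le_sum fun k _ ↦ ?_
    have := smul_le_cfc_slice (x := star x) (v := star (v (k + 1))) (s := k / n) hn0 ?_
      (hv (k + 1)).star
    · simpa using this
    · rw [← hsucc, ← hstar]; exact hker' (k + 1)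

end VonNeumannAlgebra

end Layers

/-! ### Orthogonal sums, exhaustion, and comparison of projections. -/

section Sums

variable {H : Type*} [NormedAddCommGroup H] [InnerProductSpace ℂ H] [CompleteSpace H]

local notation "⟪" x ", " y "⟫" => inner ℂ x y

open ContinuousLinearMap

theorem IsStarProjection.sum {R ι : Type*} [Ring R] [StarRing R] (p : ι → R)
    (hp : ∀ i, IsStarProjection (p i)) (h : ∀ i j, i ≠ j → p i * p j = 0) (s : Finset ι) :
    IsStarProjection (∑ i ∈ s, p i) := by
  classical
  induction s using Finset.induction_on with
  | empty => simp [IsStarProjection.zero]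
  | insert a s ha ih =>
    rw [Finset.sum_insert ha]
    refine (hp a).add ih ?_
    rw [Finset.mul_sum]
    exact Finset.sum_eq_zero fun i hi ↦ h _ _ (by rintro rfl; exact ha hi)

variable {ι : Type*} {v : ι → H →L[ℂ] H}

/-- The relations `h₂` make the vectors `v i ξ` orthogonal, and `h₁` makes finite sums of initial
projections projections, which gives the Bessel bound needed for convergence. -/
theorem exists_hasSum_partialIsometry_aux (hv : ∀ i, IsPartialIsometry (v i))
    (h₁ : ∀ i j, i ≠ j → v i * star (v j) = 0) (h₂ : ∀ i j, i ≠ j → star (v i) * v j = 0) :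
    ∃ V : H →L[ℂ] H, ∀ ξ, HasSum (fun i ↦ v i ξ) (V ξ) := by
  classical
  have hinner (ξ : H) (i j : ι) (hij : i ≠ j) : ⟪v i ξ, v j ξ⟫ = 0 := by
    rw [← inner_star_right]
    change ⟪ξ, (star (v i) * v j) ξ⟫ = 0
    rw [h₂ i j hij]; simp
  have hbound (ξ : H) (s : Finset ι) : ∑ i ∈ s, ‖v i ξ‖ ^ 2 ≤ ‖ξ‖ ^ 2 := by
    have hp : IsStarProjection (∑ i ∈ s, star (v i) * v i) := by
      refine IsStarProjection.sum _ (fun i ↦ (hv i).isStarProjection) (fun i j hij ↦ ?_) s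
      calc star (v i) * v i * (star (v j) * v j) = star (v i) * (v i * star (v j)) * v j := by
            simp only [mul_assoc]
        _ = 0 := by rw [h₁ i j hij, mul_zero, zero_mul]
    calc ∑ i ∈ s, ‖v i ξ‖ ^ 2 = (⟪ξ, (∑ i ∈ s, star (v i) * v i) ξ⟫).re := by
          rw [sum_apply, inner_sum, Complex.re_sum]
          exact Finset.sum_congr rfl fun i _ ↦ (re_inner_star_mul_self _ _).symm
      _ = ‖(∑ i ∈ s, star (v i) * v i) ξ‖ ^ 2 := by
          rw [← re_inner_star_mul_self, hp.star_mul_self]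
      _ ≤ ‖ξ‖ ^ 2 := by
          gcongr
          exact (le_of_opNorm_le _ hp.norm_le ξ).trans (one_mul _).le
  have hsum (ξ : H) : Summable fun i ↦ v i ξ := by
    let G : ι → Submodule ℂ H := fun i ↦ Submodule.span ℂ {v i ξ}
    have hG : OrthogonalFamily ℂ (fun i ↦ G i) fun i ↦ (G i).subtypeₗᵢ := by
      intro i j hij x y
      obtain ⟨a, ha⟩ := Submodule.mem_span_singleton.1 x.2
      obtain ⟨b, hb⟩ := Submodule.mem_span_singleton.1 y.2
      change ⟪(x : H), (y : H)⟫ = 0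
      rw [← ha, ← hb, inner_smul_left, inner_smul_right, hinner ξ i j hij]; simp
    refine (hG.summable_iff_norm_sq_summable fun i ↦ ⟨v i ξ, Submodule.mem_span_singleton_self _⟩).2 ?_
    exact summable_of_sum_le (fun i ↦ by positivity) (hbound ξ)
  let L : H →ₗ[ℂ] H :=
    { toFun ξ := ∑' i, v i ξ
      map_add' ξ η := by simp only [map_add]; exact (hsum ξ).tsum_add (hsum η)
      map_smul' c ξ := by simp only [map_smul, RingHom.id_apply]; exact (hsum ξ).tsum_const_smul c }
  refine ⟨L.mkContinuous 1 fun ξ ↦ ?_, fun ξ ↦ (hsum ξ).hasSum⟩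
  rw [one_mul]
  refine le_of_tendsto ((hsum ξ).hasSum.norm) (Filter.Eventually.of_forall fun s ↦ ?_)
  refine abs_le_of_sq_le_sq' ?_ (norm_nonneg ξ) |>.2
  have : ‖∑ i ∈ s, v i ξ‖ ^ 2 = ∑ i ∈ s, ‖v i ξ‖ ^ 2 := by
    have h : (⟪∑ i ∈ s, v i ξ, ∑ i ∈ s, v i ξ⟫) = ∑ i ∈ s, ((‖v i ξ‖ ^ 2 : ℝ) : ℂ) := by
      rw [sum_inner]
      refine Finset.sum_congr rfl fun i hi ↦ ?_
      rw [inner_sum, Finset.sum_eq_single_of_mem i hi fun j _ hj ↦ hinner ξ i j hj.symm,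
        inner_self_eq_norm_sq_to_K]
      push_cast; rfl
    rw [inner_self_eq_norm_sq_to_K] at h
    exact Complex.ofReal_injective (by push_cast at h ⊢; exact h)
  rw [this]
  exact hbound ξ s

/-- The strong sum of a family of partial isometries with pairwise orthogonal initial and final
projections. -/
theorem exists_hasSum_partialIsometry (hv : ∀ i, IsPartialIsometry (v i))
    (h₁ : ∀ i j, i ≠ j → v i * star (v j) = 0) (h₂ : ∀ i j, i ≠ j → star (v i) * v j = 0) :
    ∃ V : H →L[ℂ] H, IsPartialIsometry V ∧ (∀ ξ, HasSum (fun i ↦ v i ξ) (V ξ)) ∧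
      (∀ i, star (v i) * V = star (v i) * v i) ∧ (∀ i, V * star (v i) = v i * star (v i)) ∧
      (∀ ξ, HasSum (fun i ↦ ‖v i ξ‖ ^ 2) (‖V ξ‖ ^ 2)) ∧
      (∀ ξ, HasSum (fun i ↦ ‖star (v i) ξ‖ ^ 2) (‖star V ξ‖ ^ 2)) := by
  obtain ⟨V, hV⟩ := exists_hasSum_partialIsometry_aux hv h₁ h₂
  obtain ⟨V', hV'⟩ := exists_hasSum_partialIsometry_aux (v := fun i ↦ star (v i))
    (fun i ↦ (hv i).star) (fun i j hij ↦ by rw [star_star, h₂ i j hij])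
    (fun i j hij ↦ by rw [star_star, h₁ i j hij])
  -- The adjoints also sum strongly; testing against vectors identifies their sum with `star V`.
  have hVV' : V' = star V := by
    ext ξ
    refine ext_inner_left ℂ fun η ↦ ?_
    rw [inner_star_right]
    refine ((innerSL ℂ η).hasSum (hV' ξ)).unique ?_
    have h := ((innerSL ℂ ξ).hasSum (hV η)).star
    simp only [innerSL_apply_apply, RCLike.star_def, inner_conj_symm] at h
    simpa only [innerSL_apply_apply, inner_star_right] using h
  subst hVV'
  have key (w : ι → H →L[ℂ] H) (W : H →L[ℂ] H) (hW : ∀ ξ, HasSum (fun i ↦ w i ξ) (W ξ))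
      (hw : ∀ i j, i ≠ j → star (w i) * w j = 0) (i : ι) : star (w i) * W = star (w i) * w i := by
    ext ξ
    refine ((star (w i)).hasSum (hW ξ)).unique (hasSum_single i fun j hj ↦ ?_)
    exact congrArg (fun T : H →L[ℂ] H ↦ T ξ) (hw i j hj.symm)
  have h3 := key v V hV h₂
  have h4 (i : ι) : V * star (v i) = v i * star (v i) := by
    have := congrArg star (key _ _ hV' (fun i j hij ↦ by rw [star_star, h₁ i j hij]) i)
    simpa using this
  have hnorm (w : ι → H →L[ℂ] H) (W : H →L[ℂ] H) (hW : ∀ ξ, HasSum (fun i ↦ w i ξ) (W ξ))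
      (hw : ∀ i, star (w i) * W = star (w i) * w i) (ξ : H) :
      HasSum (fun i ↦ ‖w i ξ‖ ^ 2) (‖W ξ‖ ^ 2) := by
    have h := Complex.hasSum_re ((innerSL ℂ (W ξ)).hasSum (hW ξ))
    have h0 (x : H) : (⟪x, x⟫).re = ‖x‖ ^ 2 := inner_self_eq_norm_sq (𝕜 := ℂ) x
    have h1 (i : ι) : (⟪W ξ, w i ξ⟫).re = ‖w i ξ‖ ^ 2 := by
      rw [← re_inner_star_mul_self, ← hw i]
      change _ = (⟪ξ, star (w i) (W ξ)⟫).re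
      rw [inner_star_right, ← inner_conj_symm, Complex.conj_re]
    simpa only [innerSL_apply_apply, h1, h0] using h
  have h4' (i : ι) : star (star (v i)) * star V = star (star (v i)) * star (v i) :=
    key _ _ hV' (fun i j hij ↦ by rw [star_star, h₁ i j hij]) i
  refine ⟨V, ?_, hV, h3, h4, hnorm v V hV h3, hnorm _ _ hV' h4'⟩
  have h5 (i : ι) : V * star V * v i = v i := by
    have h6 : star V * v i = star (v i) * v i := by
      have := congrArg star (h3 i)
      simpa using this
    rw [mul_assoc, h6, ← mul_assoc, h4]
    exact hv i
  ext ξ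
  have h7 : (fun i ↦ (V * star V) (v i ξ)) = fun i ↦ v i ξ :=
    funext fun i ↦ DFunLike.congr_fun (h5 i) ξ
  exact ((V * star V).hasSum (hV ξ)).unique (h7 ▸ hV ξ)

theorem mul_eq_mul_of_hasSum {V S T : H →L[ℂ] H} (hV : ∀ ξ, HasSum (fun i ↦ v i ξ) (V ξ))
    (h : ∀ i, T * v i = v i * S) : T * V = V * S := by
  ext ξ
  have h' : (fun i ↦ T (v i ξ)) = fun i ↦ v i (S ξ) := funext fun i ↦ DFunLike.congr_fun (h i) ξ
  exact (T.hasSum (hV ξ)).unique (h' ▸ hV (S ξ))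

namespace VonNeumannAlgebra

variable {M : VonNeumannAlgebra H}

theorem mem_of_hasSum {V : H →L[ℂ] H} (hV : ∀ ξ, HasSum (fun i ↦ v i ξ) (V ξ))
    (h : ∀ i, v i ∈ M) : V ∈ M :=
  mem_of_commutes fun _ hT ↦ mul_eq_mul_of_hasSum hV fun i ↦ commutes_of_mem (h i) hT

/-- Exhaustion: if every pair of nonzero subprojections of `e` and `f` admits a nonzero partial
isometry satisfying an estimate on vector functionals, these partial isometries can be summed
until `e` or `f` is used up. -/
theorem exists_maximal_partialIsometry {e f : H →L[ℂ] H} (heM : e ∈ M) (hfM : f ∈ M)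
    (he : IsStarProjection e) (hf : IsStarProjection f) (ξ : H) (c : ℝ)
    (h : ∀ e' f', e' ∈ M → f' ∈ M → IsStarProjection e' → IsStarProjection f' →
      e' * e = e' → f * f' = f' → e' ≠ 0 → f' ≠ 0 →
      ∃ v ∈ M, IsPartialIsometry v ∧ v ≠ 0 ∧ v * e' = v ∧ f' * v = v ∧
        c * ‖star v ξ‖ ^ 2 ≤ ‖v ξ‖ ^ 2) :
    ∃ V ∈ M, IsPartialIsometry V ∧ V * e = V ∧ f * V = V ∧ c * ‖star V ξ‖ ^ 2 ≤ ‖V ξ‖ ^ 2 ∧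
      (star V * V = e ∨ V * star V = f) := by
  let good (v : H →L[ℂ] H) : Prop := v ∈ M ∧ IsPartialIsometry v ∧ v ≠ 0 ∧ v * e = v ∧ f * v = v ∧
    c * ‖star v ξ‖ ^ 2 ≤ ‖v ξ‖ ^ 2
  let 𝒮 : Set (Set (H →L[ℂ] H)) :=
    {s | (∀ v ∈ s, good v) ∧ s.Pairwise fun v w ↦ v * star w = 0 ∧ star v * w = 0}
  obtain ⟨s, hs⟩ := zorn_subset 𝒮 fun C hC hchain ↦ by
    refine ⟨⋃₀ C, ⟨?_, ?_⟩, fun t ht ↦ Set.subset_sUnion_of_mem ht⟩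
    · rintro v ⟨t, ht, hv⟩
      exact (hC ht).1 v hv
    · exact (Set.pairwise_sUnion hchain.directedOn).2 fun t ht ↦ (hC ht).2
  have hgood := hs.prop.1
  have hpw := hs.prop.2
  have hne (i j : s) (hij : i ≠ j) : (i : H →L[ℂ] H) ≠ j := fun h ↦ hij (Subtype.ext h)
  obtain ⟨V, hVPI, hV, hV1, hV2, hn1, hn2⟩ := exists_hasSum_partialIsometry
    (v := fun i : s ↦ (i : H →L[ℂ] H)) (fun i ↦ (hgood i i.2).2.1)
    (fun i j hij ↦ (hpw i.2 j.2 (hne i j hij)).1) (fun i j hij ↦ (hpw i.2 j.2 (hne i j hij)).2)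
  have hVM : V ∈ M := mem_of_hasSum hV fun i ↦ (hgood i i.2).1
  have hVe : V * e = V := by
    ext η
    have h' : (fun i : s ↦ (i : H →L[ℂ] H) (e η)) = fun i : s ↦ (i : H →L[ℂ] H) η :=
      funext fun i ↦ DFunLike.congr_fun (hgood i i.2).2.2.2.1 η
    exact (hV (e η)).unique (h' ▸ hV η)
  have hfV : f * V = V := by
    rw [mul_eq_mul_of_hasSum (S := 1) hV fun i ↦ by rw [mul_one]; exact (hgood i i.2).2.2.2.2.1,
      mul_one]
  refine ⟨V, hVM, hVPI, hVe, hfV, ?_, ?_⟩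
  · exact hasSum_le (fun i : s ↦ (hgood i i.2).2.2.2.2.2) ((hn2 ξ).mul_left c) (hn1 ξ)
  by_contra! hcon
  have heV : e * (star V * V) = star V * V := by
    have := congrArg star hVe
    rw [star_mul, he.isSelfAdjoint.star_eq] at this
    rw [← mul_assoc, this]
  have hVf : (V * star V) * f = V * star V := by
    have := congrArg star hfV
    rw [star_mul, hf.isSelfAdjoint.star_eq] at this
    rw [mul_assoc, this]
  have hp : IsStarProjection (e - star V * V) :=
    hVPI.isStarProjection.sub_of_mul_eq_right he heV
  have hq : IsStarProjection (f - V * star V) :=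
    hVPI.isStarProjection'.sub_of_mul_eq_left hf hVf
  -- If both leftovers are nonzero, the hypothesis supplies a further partial isometry, orthogonal
  -- on both sides to the whole maximal family.
  obtain ⟨v, hvM, hvPI, hv0, hve, hfv, hvξ⟩ := h (e - star V * V) (f - V * star V)
    (sub_mem heM (mul_mem (star_mem hVM) hVM)) (sub_mem hfM (mul_mem hVM (star_mem hVM))) hp hq
    (by rw [sub_mul, he.isIdempotentElem.eq, mul_assoc, hVe])
    (by rw [mul_sub, hf.isIdempotentElem.eq, ← mul_assoc, hfV])
    (sub_ne_zero.2 hcon.1.symm) (sub_ne_zero.2 hcon.2.symm)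
  have hvv : v * e = v := by
    conv_lhs => rw [← hve]
    rw [mul_assoc, sub_mul, he.isIdempotentElem.eq, mul_assoc, hVe, hve]
  have hvv' : f * v = v := by
    conv_lhs => rw [← hfv]
    rw [← mul_assoc, mul_sub, hf.isIdempotentElem.eq, ← mul_assoc, hfV, hfv]
  have horth1 (w) (hw : w ∈ s) : v * star w = 0 := by
    have hew : e * star w = star w := by
      have := congrArg star (hgood w hw).2.2.2.1
      rwa [star_mul, he.isSelfAdjoint.star_eq] at this
    have : star V * V * star w = star w := by
      rw [mul_assoc, hV2 ⟨w, hw⟩, ← mul_assoc]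
      have h6 : star V * w = star w * w := by
        have := congrArg star (hV1 ⟨w, hw⟩)
        simpa using this
      rw [h6, mul_assoc]
      exact (hgood w hw).2.1.star_eq
    rw [← hve, mul_assoc, sub_mul, hew, this, sub_self, mul_zero]
  have horth2 (w) (hw : w ∈ s) : star v * w = 0 := by
    have : V * star V * w = w := by
      have h6 : star V * w = star w * w := by
        have := congrArg star (hV1 ⟨w, hw⟩)
        simpa using this
      rw [mul_assoc, h6, ← mul_assoc, hV2 ⟨w, hw⟩]
      exact (hgood w hw).2.1
    rw [← hfv, star_mul, hq.isSelfAdjoint.star_eq, mul_assoc, sub_mul, (hgood w hw).2.2.2.2.1, this,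
      sub_self, mul_zero]
  have hvs : v ∈ s := by
    refine hs.le_of_ge (y := insert v s) ⟨?_, ?_⟩ (Set.subset_insert v s) (Set.mem_insert v s)
    · rintro w (rfl | hw)
      · exact ⟨hvM, hvPI, hv0, hvv, hvv', hvξ⟩
      · exact hgood w hw
    · refine hpw.insert fun w hw _ ↦ ⟨⟨horth1 w hw, horth2 w hw⟩, ?_, ?_⟩
      · have := congrArg star (horth1 w hw); simpa using this
      · have := congrArg star (horth2 w hw); simpa using this
  -- Maximality puts `v` into `s`, so `v` is orthogonal to itself.
  apply hv0
  rw [← hvPI, horth1 v hvs, zero_mul]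

/-- If `f M e = 0`, the projection onto the closed span of `M e H` is invariant under both `M` and
its commutant, hence a scalar. It fixes the range of `e` and is annihilated by `f`, which is
impossible for nonzero `e` and `f`. -/
theorem IsFactor.exists_mul_mul_ne_zero (hM : M.IsFactor) {e f : H →L[ℂ] H} (he0 : e ≠ 0)
    (heM : e ∈ M) (hf0 : f ≠ 0) : ∃ x ∈ M, f * x * e ≠ 0 := by
  by_contra! hcon
  set S := Submodule.span ℂ {η | ∃ x ∈ M, ∃ ζ, η = x (e ζ)} with hS
  set K := S.topologicalClosure with hK
  have hinv (T : H →L[ℂ] H) (hT : ∀ x ∈ M, ∀ ζ, T (x (e ζ)) ∈ S) :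
      K.starProjection.range ∈ Module.End.invtSubmodule (T : H →ₗ[ℂ] H) := by
    rw [Submodule.range_starProjection]
    have h1 : S ≤ S.comap (T : H →ₗ[ℂ] H) := by
      refine Submodule.span_le.2 ?_
      rintro _ ⟨x, hx, ζ, rfl⟩
      exact hT x hx ζ
    exact fun ζ hζ ↦ map_mem_closure (f := T) T.continuous hζ fun a ha ↦ h1 ha
  have hKproj : IsStarProjection K.starProjection := isStarProjection_starProjection
  have h1 : K.starProjection ∈ M := by
    refine (IsStarProjection.mem_iff hKproj M).2 fun T hT ↦ hinv T fun x hx ζ ↦ ?_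
    have h2 : T (x (e ζ)) = x (e (T ζ)) := by
      change (T * (x * e)) ζ = (x * e * T) ζ
      rw [commutes_of_mem (mul_mem hx heM) hT]
    rw [h2]
    exact Submodule.subset_span ⟨x, hx, T ζ, rfl⟩
  have h2 : K.starProjection ∈ M.commutant := by
    refine (IsStarProjection.mem_iff hKproj _).2 fun T hT ↦ hinv T fun x hx ζ ↦ ?_
    rw [commutant_commutant] at hT
    exact Submodule.subset_span ⟨T * x, mul_mem hT hx, ζ, rfl⟩
  obtain ⟨c, hc⟩ := hM.center _ h1 h2
  have h3 : K.starProjection * e = e := by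
    ext ζ
    refine Submodule.starProjection_eq_self_iff.2 (S.le_topologicalClosure ?_)
    exact Submodule.subset_span ⟨1, one_mem M, ζ, rfl⟩
  have h4 : f * K.starProjection = 0 := by
    have h5 : K ≤ f.ker := by
      refine Submodule.topologicalClosure_minimal _ (Submodule.span_le.2 ?_)
        (ContinuousLinearMap.isClosed_ker _)
      rintro _ ⟨x, hx, ζ, rfl⟩
      exact congrArg (fun T : H →L[ℂ] H ↦ T ζ) (hcon x hx)
    ext ζ
    exact h5 (Submodule.starProjection_apply_mem K ζ)
  rw [hc, smul_mul_assoc, one_mul] at h3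
  rw [hc, mul_smul_comm, mul_one, smul_eq_zero] at h4
  rcases h4 with h4 | h4
  · rw [h4, zero_smul] at h3; exact he0 h3.symm
  · exact hf0 h4

/-- Any two nonzero projections of a factor have equivalent nonzero subprojections. -/
theorem IsFactor.exists_partialIsometry (hM : M.IsFactor) {e f : H →L[ℂ] H} (heM : e ∈ M)
    (hfM : f ∈ M) (he : IsStarProjection e) (hf : IsStarProjection f) (he0 : e ≠ 0) (hf0 : f ≠ 0) :
    ∃ v ∈ M, IsPartialIsometry v ∧ v ≠ 0 ∧ v * e = v ∧ f * v = v := by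
  obtain ⟨x, hx, hfx⟩ := hM.exists_mul_mul_ne_zero he0 heM hf0
  obtain ⟨v, hvM, hv, hk, hk', hyv, -⟩ := exists_polar (mul_mem (mul_mem hfM hx) heM)
  refine ⟨v, hvM, hv, ?_, ?_, ?_⟩
  · rintro rfl; exact hfx (by rw [← hyv, mul_zero, mul_zero])
  · have : v * (1 - e) = 0 := by
      ext ζ
      refine hk _ ?_
      change (f * x * e * (1 - e)) ζ = 0
      rw [mul_assoc _ e, he.mul_one_sub_self, mul_zero]; rfl
    rw [mul_sub, mul_one, sub_eq_zero] at this
    exact this.symm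
  · have : star v * (1 - f) = 0 := by
      ext ζ
      refine hk' _ ?_
      change (star (f * x * e) * (1 - f)) ζ = 0
      rw [mul_assoc f, star_mul, hf.isSelfAdjoint.star_eq, mul_assoc, hf.mul_one_sub_self,
        mul_zero]; rfl
    rw [mul_sub, mul_one, sub_eq_zero] at this
    have h := congrArg star this
    rw [star_mul, star_star, hf.isSelfAdjoint.star_eq] at h
    exact h.symm

/-- In a finite von Neumann algebra no projection is equivalent to a proper subprojection. -/
theorem IsFinite.mul_star_eq (hM : M.IsFinite) {V f : H →L[ℂ] H} (hVM : V ∈ M)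
    (hf : IsStarProjection f) (hV : star V * V = f) (hfV : f * V = V) : V * star V = f := by
  have hfM : f ∈ M := hV ▸ mul_mem (star_mem hVM) hVM
  have hPI : IsPartialIsometry V := isPartialIsometry_of_isStarProjection (hV ▸ hf)
  have hVf : V * f = V := by rw [← hV]; exact hPI.eq
  have hsV : star V * f = star V := by
    have := congrArg star hfV
    rwa [star_mul, hf.isSelfAdjoint.star_eq] at this
  have hfs : f * star V = star V := by
    have := congrArg star hVf
    rwa [star_mul, hf.isSelfAdjoint.star_eq] at this
  -- Adding the identity of the complementary corner extends `V` to an isometry of `M`, to which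
  -- finiteness applies.
  have h1 : star (V + (1 - f)) * (V + (1 - f)) = 1 := by
    rw [star_add, hf.one_sub.isSelfAdjoint.star_eq]
    simp only [mul_add, add_mul, mul_sub, sub_mul, mul_one, one_mul, hV, hfV, hsV,
      hf.isIdempotentElem.eq]
    abel
  have h2 : (V + (1 - f)) * star (V + (1 - f)) = V * star V + (1 - f) := by
    rw [star_add, hf.one_sub.isSelfAdjoint.star_eq]
    simp only [mul_add, add_mul, mul_sub, sub_mul, mul_one, one_mul, hVf, hfs,
      hf.isIdempotentElem.eq]
    abel
  have hWM : V + (1 - f) ∈ M := add_mem hVM (sub_mem (one_mem M) hfM)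
  have hW : IsPartialIsometry (V + (1 - f)) :=
    isPartialIsometry_of_isStarProjection (by rw [h1]; exact IsStarProjection.one _)
  have := hM _ (mul_mem hWM (star_mem hWM)) hW.isStarProjection' ⟨_, hWM, h1, rfl⟩
  rw [h2] at this
  have h3 : V * star V = f + (V * star V + (1 - f)) - 1 := by abel
  rw [h3, this, add_sub_cancel_right]

end VonNeumannAlgebra

end Sums

/-! ### Almost tracial corners of a finite factor. -/

section Homogeneous

variable {H : Type*} [NormedAddCommGroup H] [InnerProductSpace ℂ H] [CompleteSpace H]

local notation "⟪" x ", " y "⟫" => inner ℂ x y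

open ContinuousLinearMap

/-- `v` maps the initial space of `u` into its final space, and vanishes off that initial space. -/
def SupportedUnder (v u : H →L[ℂ] H) : Prop := v * (star u * u) = v ∧ u * star u * v = v

theorem IsPartialIsometry.supportedUnder_self {u : H →L[ℂ] H} (hu : IsPartialIsometry u) :
    SupportedUnder u u := ⟨hu.eq, hu⟩

namespace SupportedUnder

variable {u v w : H →L[ℂ] H}

theorem trans (h : SupportedUnder v w) (h' : SupportedUnder w u) : SupportedUnder v u := by
  have h1 : star w * w * (star u * u) = star w * w := by rw [mul_assoc, h'.1]
  have h2 : u * star u * (w * star w) = w * star w := by rw [← mul_assoc, h'.2]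
  exact ⟨by rw [← h.1, mul_assoc, h1], by rw [← h.2, ← mul_assoc, h2]⟩

theorem star (h : SupportedUnder v u) : SupportedUnder (star v) (star u) := by
  have h1 := congrArg Star.star h.1
  have h2 := congrArg Star.star h.2
  simp only [star_mul, star_star] at h1 h2
  exact ⟨by rw [star_star]; exact h2, by rw [star_star]; exact h1⟩

end SupportedUnder

theorem norm_apply_eq_of_star_mul_self_eq {a b : H →L[ℂ] H} (h : star a * a = star b * b) (ξ : H) :
    ‖a ξ‖ = ‖b ξ‖ := by
  have := re_inner_star_mul_self a ξ
  rw [h, re_inner_star_mul_self] at this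
  exact ((sq_eq_sq₀ (norm_nonneg _) (norm_nonneg _)).1 this).symm

theorem re_inner_smul_sum (s : Finset ℕ) (c : ℝ) (v : ℕ → H →L[ℂ] H) (ξ : H) :
    (⟪ξ, (c • ∑ k ∈ s, star (v k) * v k) ξ⟫).re = c * ∑ k ∈ s, ‖v k ξ‖ ^ 2 := by
  change (⟪ξ, c • ((∑ k ∈ s, star (v k) * v k) ξ)⟫).re = _
  rw [inner_smul_right_eq_smul, Complex.smul_re, sum_apply, inner_sum, Complex.re_sum, smul_eq_mul]
  simp_rw [re_inner_star_mul_self]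

theorem re_inner_mono {S T : H →L[ℂ] H} (h : S ≤ T) (ξ : H) : (⟪ξ, S ξ⟫).re ≤ (⟪ξ, T ξ⟫).re := by
  have h3 : 0 ≤ (⟪ξ, _⟫).re := ((le_def _ _).1 h).re_inner_nonneg_right ξ
  rwa [sub_apply, inner_sub_right, Complex.sub_re, sub_nonneg] at h3

namespace VonNeumannAlgebra

variable {M : VonNeumannAlgebra H}

/-- Transport to one corner: `V * star u` has initial projection `u * star u` and final projection
`V * star V`. -/
theorem IsFinite.mul_star_eq_of_star_mul_eq (hM : M.IsFinite) {V u : H →L[ℂ] H} (hVM : V ∈ M)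
    (huM : u ∈ M) (hu : IsPartialIsometry u) (hV : star V * V = star u * u)
    (huV : u * star u * V = V) : V * star V = u * star u := by
  have hPI : IsPartialIsometry V :=
    isPartialIsometry_of_isStarProjection (hV ▸ hu.isStarProjection)
  have h := hM.mul_star_eq (V := V * star u) (mul_mem hVM (star_mem huM)) hu.isStarProjection'
    (by
      rw [star_mul, star_star]
      calc u * star V * (V * star u) = u * (star V * V) * star u := by simp only [mul_assoc]
        _ = u * star u := by rw [hV, hu.eq])
    (by rw [← mul_assoc, huV])
  rw [← h, star_mul, star_star]
  calc V * star V = V * (star V * V) * star V := by rw [hPI.eq]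
    _ = V * star u * (u * star V) := by rw [hV]; simp only [mul_assoc]

/-- If a partial isometry satisfies a strict estimate on a vector functional, then under it there
is one all of whose sub-isometries satisfy that estimate. -/
theorem IsFactor.exists_forall_norm_sq_le (hM : M.IsFactor) (hfin : M.IsFinite) {u : H →L[ℂ] H}
    (huM : u ∈ M) (hu : IsPartialIsometry u) {ξ : H} {c : ℝ}
    (h : ‖u ξ‖ ^ 2 < c * ‖star u ξ‖ ^ 2) :
    ∃ u' ∈ M, IsPartialIsometry u' ∧ u' ≠ 0 ∧ SupportedUnder u' u ∧
      ∀ v ∈ M, IsPartialIsometry v → SupportedUnder v u' → ‖v ξ‖ ^ 2 ≤ c * ‖star v ξ‖ ^ 2 := by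
  -- Otherwise every nonzero piece of `u` contains a violator, and the exhaustion sums violators to
  -- a `V` satisfying the reversed estimate.
  by_contra! hcon
  obtain ⟨V, hVM, hV, hVe, hfV, hVξ, hmax⟩ := exists_maximal_partialIsometry (e := star u * u)
    (f := u * star u) (mul_mem (star_mem huM) huM) (mul_mem huM (star_mem huM))
    hu.isStarProjection hu.isStarProjection' ξ c
    (fun e' f' heM hfM he hf hee hff he0 hf0 ↦ by
      obtain ⟨u', hu'M, hu', hu'0, hu'e, hfu'⟩ := hM.exists_partialIsometry heM hfM he hf he0 hf0
      obtain ⟨v, hvM, hv, ⟨hv1, hv2⟩, hvξ⟩ := hcon u' hu'M hu' hu'0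
        ⟨by rw [← hu'e, mul_assoc, hee], by rw [← hfu', ← mul_assoc, hff]⟩
      refine ⟨v, hvM, hv, ?_, ?_, ?_, hvξ.le⟩
      · rintro rfl
        simp at hvξ
      · rw [← hv1, mul_assoc, mul_assoc, hu'e]
      · rw [← hv2, ← mul_assoc, ← mul_assoc, hfu'])
  -- Whichever side is exhausted, finiteness exhausts the other, so `V` and `u` have the same norms
  -- at `ξ` and `hVξ` contradicts `h`.
  have hboth : star V * V = star u * u ∧ V * star V = u * star u := by
    rcases hmax with h1 | h1
    · exact ⟨h1, hfin.mul_star_eq_of_star_mul_eq hVM huM hu h1 hfV⟩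
    · refine ⟨?_, h1⟩
      have h2 := hfin.mul_star_eq_of_star_mul_eq (V := star V) (u := star u) (star_mem hVM)
        (star_mem huM) hu.star (by simpa using h1)
        (by have := congrArg star hVe; simpa [mul_assoc] using this)
      simpa using h2
  have h1 := norm_apply_eq_of_star_mul_self_eq hboth.1 ξ
  have h2 := norm_apply_eq_of_star_mul_self_eq (a := star V) (b := star u)
    (by simpa using hboth.2) ξ
  rw [h1, h2] at hVξ
  exact absurd h (not_lt.2 hVξ)

theorem IsFactor.exists_forall_norm_sq_le' (hM : M.IsFactor) (hfin : M.IsFinite) {u : H →L[ℂ] H}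
    (huM : u ∈ M) (hu : IsPartialIsometry u) {ξ : H} {c : ℝ}
    (h : ‖star u ξ‖ ^ 2 < c * ‖u ξ‖ ^ 2) :
    ∃ u' ∈ M, IsPartialIsometry u' ∧ u' ≠ 0 ∧ SupportedUnder u' u ∧
      ∀ v ∈ M, IsPartialIsometry v → SupportedUnder v u' → ‖star v ξ‖ ^ 2 ≤ c * ‖v ξ‖ ^ 2 := by
  obtain ⟨u', hu'M, hu', hu'0, hsub, hbd⟩ := hM.exists_forall_norm_sq_le hfin (star_mem huM) hu.star
    (ξ := ξ) (by simpa using h)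
  refine ⟨star u', star_mem hu'M, hu'.star, star_ne_zero.2 hu'0, by simpa using hsub.star,
    fun v hvM hv hvu ↦ ?_⟩
  simpa using hbd (star v) (star_mem hvM) hv.star (by simpa using hvu.star)

/-- The support projection of a vector functional. -/
theorem exists_support_projection (M : VonNeumannAlgebra H) (ξ : H) :
    ∃ s ∈ M, IsStarProjection s ∧ s ξ = ξ ∧ ∀ v ∈ M, v ξ = 0 → v * s = 0 := by
  -- The closed span of the commutant orbit of `ξ` is commutant-invariant, so its projection lies in
  -- `M`; an element of `M` killing `ξ` kills the orbit.
  set S := Submodule.span ℂ {η | ∃ T ∈ M.commutant, η = T ξ} with hS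
  set K := S.topologicalClosure with hK
  have hKproj : IsStarProjection K.starProjection := isStarProjection_starProjection
  refine ⟨K.starProjection, ?_, hKproj, ?_, fun v hv hvξ ↦ ?_⟩
  · refine (IsStarProjection.mem_iff hKproj M).2 fun T hT ↦ ?_
    rw [Submodule.range_starProjection]
    have h1 : S ≤ S.comap (T : H →ₗ[ℂ] H) := by
      refine Submodule.span_le.2 ?_
      rintro _ ⟨x, hx, rfl⟩
      exact Submodule.subset_span ⟨T * x, mul_mem hT hx, rfl⟩
    exact fun ζ hζ ↦ map_mem_closure (f := T) T.continuous hζ fun a ha ↦ h1 ha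
  · refine Submodule.starProjection_eq_self_iff.2 (S.le_topologicalClosure ?_)
    exact Submodule.subset_span ⟨1, one_mem _, rfl⟩
  · have h5 : K ≤ v.ker := by
      refine Submodule.topologicalClosure_minimal _ (Submodule.span_le.2 ?_)
        (ContinuousLinearMap.isClosed_ker _)
      rintro _ ⟨T, hT, rfl⟩
      change (v * T) ξ = 0
      rw [← commutes_of_mem hv hT]
      change T (v ξ) = 0
      rw [hvξ, map_zero]
    ext ζ
    exact h5 (Submodule.starProjection_apply_mem K ζ)

/-- In a finite factor, every nonzero vector functional is almost tracial on partial isometries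
supported by a suitable projection. -/
theorem IsFactor.exists_projection_almost_tracial (hM : M.IsFactor) (hfin : M.IsFinite) {ξ : H}
    (hξ : ξ ≠ 0) {κ : ℝ} (hκ : 1 < κ) :
    ∃ g ∈ M, IsStarProjection g ∧ g ξ ≠ 0 ∧ ∀ v ∈ M, IsPartialIsometry v → v * g = v → g * v = v →
      ‖v ξ‖ ^ 2 ≤ κ * ‖star v ξ‖ ^ 2 := by
  obtain ⟨s, hsM, hs, hsξ, hsv⟩ := M.exists_support_projection ξ
  have hsPI := hs.isPartialIsometry
  have hnz (v) (hvM : v ∈ M) (hv0 : v ≠ 0) (hvs : SupportedUnder v s) : 0 < ‖v ξ‖ ^ 2 := by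
    refine pow_pos (norm_pos_iff.2 fun h ↦ hv0 ?_) 2
    have := hsv v hvM h
    rw [← hvs.1, hs.star_mul_self, this]
  have hstar (v) (hvs : SupportedUnder v s) : SupportedUnder (star v) s := by
    simpa [hs.isSelfAdjoint.star_eq] using hvs.star
  -- Any constant above `1` works for `u = s`. This bounds the ratio `‖v ξ‖² / ‖v⋆ ξ‖²` below by
  -- `1/2` under `u₁`, so the infimum taken next is positive.
  obtain ⟨u₁, hu₁M, hu₁, hu₁0, hu₁s, hb₁⟩ := hM.exists_forall_norm_sq_le' hfin hsM hsPI (ξ := ξ)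
    (c := 2) (by
      have := pow_pos (norm_pos_iff.2 hξ) 2
      rw [hs.isSelfAdjoint.star_eq, hsξ]; linarith)
  -- Upper bounds for the ratio valid on all sub-isometries of some nonzero piece of `u₁`.
  let C : Set ℝ := {c | 0 ≤ c ∧ ∃ u ∈ M, IsPartialIsometry u ∧ u ≠ 0 ∧ SupportedUnder u u₁ ∧
    ∀ v ∈ M, IsPartialIsometry v → SupportedUnder v u → ‖v ξ‖ ^ 2 ≤ c * ‖star v ξ‖ ^ 2}
  have hCne : C.Nonempty := by
    have h1 : 0 < ‖star u₁ ξ‖ ^ 2 :=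
      hnz _ (star_mem hu₁M) (star_ne_zero.2 hu₁0) (hstar _ hu₁s)
    have hc : 0 ≤ ‖u₁ ξ‖ ^ 2 / ‖star u₁ ξ‖ ^ 2 + 1 := by positivity
    refine ⟨_, hc, hM.exists_forall_norm_sq_le hfin hu₁M hu₁ ?_⟩
    rw [add_mul, div_mul_cancel₀ _ h1.ne']
    linarith
  have hClow (c) (hcC : c ∈ C) : 1 / 2 ≤ c := by
    obtain ⟨hc, u, huM, hu, hu0, huu₁, hb⟩ := hcC
    have h1 := hb u huM hu hu.supportedUnder_self
    have h2 := hb₁ u huM hu huu₁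
    have h3 := hnz u huM hu0 (huu₁.trans hu₁s)
    by_contra! hlt
    nlinarith [mul_le_mul_of_nonneg_left h2 hc]
  set c₀ := sInf C with hc₀
  have hbdd : BddBelow C := ⟨1 / 2, hClow⟩
  have hc₀pos : 0 < c₀ := lt_of_lt_of_le (by norm_num) (le_csInf hCne hClow)
  -- A piece `u₂` has all ratios below `c₀ * r`. Since `c₀ / r` is not in `C`, some `u₃` under `u₂`
  -- exceeds it, and a piece `w` of `u₃` has all ratios at least `c₀ / r`. Under `w` the ratios thus
  -- vary by at most `r² = κ`.
  set r := √κ with hr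
  have hr1 : 1 < r := Real.lt_sqrt_of_sq_lt (by simpa using hκ)
  have hrr : r * r = κ := Real.mul_self_sqrt (by linarith)
  obtain ⟨c, ⟨hc, u₂, hu₂M, hu₂, hu₂0, hu₂₁, hb₂⟩, hcr⟩ :=
    exists_lt_of_csInf_lt hCne (show sInf C < c₀ * r by rw [← hc₀]; nlinarith)
  have hnot : c₀ / r ∉ C := notMem_of_lt_csInf (div_lt_self hc₀pos hr1) hbdd
  obtain ⟨u₃, hu₃M, hu₃, hu₃₂, hlt⟩ : ∃ u₃ ∈ M, IsPartialIsometry u₃ ∧ SupportedUnder u₃ u₂ ∧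
      c₀ / r * ‖star u₃ ξ‖ ^ 2 < ‖u₃ ξ‖ ^ 2 := by
    by_contra! hcon
    exact hnot ⟨by positivity, u₂, hu₂M, hu₂, hu₂0, hu₂₁, hcon⟩
  obtain ⟨w, hwM, hw, hw0, hwu₃, hb₄⟩ := hM.exists_forall_norm_sq_le' hfin hu₃M hu₃ (ξ := ξ)
    (c := r / c₀) (by
      rw [div_mul_eq_mul_div, lt_div_iff₀ hc₀pos]
      rw [div_mul_eq_mul_div, div_lt_iff₀ (by positivity)] at hlt
      linarith)
  have hgproj := hw.isStarProjection
  refine ⟨star w * w, mul_mem (star_mem hwM) hwM, hgproj, ?_, fun v hvM hv hvg hgv ↦ ?_⟩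
  · rw [Ne, star_mul_self_apply_eq_zero]
    have := hnz w hwM hw0 (((hwu₃.trans hu₃₂).trans hu₂₁).trans hu₁s)
    intro h0
    rw [h0] at this; simp at this
  have hvsg : star v * (star w * w) = star v := by
    have := congrArg star hgv
    rwa [star_mul, hgproj.isSelfAdjoint.star_eq] at this
  have hp := hv.isStarProjection'
  have hgp : star w * w * (v * star v) = v * star v := by rw [← mul_assoc, hgv]
  -- Compare `w v` with `w v v⋆`: both lie under `w` and have the same final projection, while their
  -- initial projections are `v⋆v` and `vv⋆`. The common final term cancels.
  have hPI1 : IsPartialIsometry (w * v) := by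
    rw [IsPartialIsometry, star_mul]
    calc w * v * (star v * star w) * (w * v) = w * (v * star v) * (star w * w * v) := by
          simp only [mul_assoc]
      _ = w * v := by rw [hgv, mul_assoc, hv]
  have hPI2 : IsPartialIsometry (w * (v * star v)) := hp.isPartialIsometry_mul hgp
  have hS1 : SupportedUnder (w * v) w := ⟨by rw [mul_assoc, hvg], by rw [← mul_assoc, hw]⟩
  have hS2 : SupportedUnder (w * (v * star v)) w :=
    ⟨by rw [mul_assoc, mul_assoc, hvsg], by rw [← mul_assoc, hw]⟩
  have hM1 : w * v ∈ M := mul_mem hwM hvM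
  have hM2 : w * (v * star v) ∈ M := mul_mem hwM (mul_mem hvM (star_mem hvM))
  have e1 : ‖(w * v) ξ‖ = ‖v ξ‖ := norm_apply_eq_of_star_mul_self_eq (by
    rw [star_mul]
    calc star v * star w * (w * v) = star v * (star w * w * v) := by simp only [mul_assoc]
      _ = star v * v := by rw [hgv]) ξ
  have e2 : ‖star (w * v) ξ‖ = ‖star (w * (v * star v)) ξ‖ := norm_apply_eq_of_star_mul_self_eq (by
    rw [star_star, star_star, star_mul, star_mul, hp.isSelfAdjoint.star_eq]
    calc w * v * (star v * star w) = w * (v * star v) * star w := by simp only [mul_assoc]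
      _ = w * ((v * star v) * (v * star v)) * star w := by rw [hp.isIdempotentElem.eq]
      _ = w * (v * star v) * (v * star v * star w) := by simp only [mul_assoc]) ξ
  have e3 : ‖(w * (v * star v)) ξ‖ = ‖star v ξ‖ := norm_apply_eq_of_star_mul_self_eq (by
    rw [star_mul, star_star, hp.isSelfAdjoint.star_eq]
    calc v * star v * star w * (w * (v * star v)) = v * star v * (star w * w * (v * star v)) := by
          simp only [mul_assoc]
      _ = v * star v := by rw [hgp, hp.isIdempotentElem.eq]) ξ
  have i1 := hb₂ _ hM1 hPI1 (hS1.trans (hwu₃.trans hu₃₂))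
  have i2 := hb₄ _ hM2 hPI2 hS2
  rw [e1, e2] at i1
  rw [e3] at i2
  calc ‖v ξ‖ ^ 2 ≤ c * ‖star (w * (v * star v)) ξ‖ ^ 2 := i1
    _ ≤ c₀ * r * (r / c₀ * ‖star v ξ‖ ^ 2) := by gcongr
    _ = κ * ‖star v ξ‖ ^ 2 := by rw [← hrr]; field_simp

/-- An estimate on partial isometries extends to all elements of the corner, by the layer-cake
decomposition. -/
theorem norm_sq_le_of_forall_partialIsometry {g : H →L[ℂ] H} (hg : IsStarProjection g) {ξ : H}
    {κ : ℝ} (hκ : 0 ≤ κ)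
    (h : ∀ v ∈ M, IsPartialIsometry v → v * g = v → g * v = v → ‖v ξ‖ ^ 2 ≤ κ * ‖star v ξ‖ ^ 2)
    {x : H →L[ℂ] H} (hx : x ∈ M) (hxg : x * g = x) (hgx : g * x = x) :
    ‖x ξ‖ ^ 2 ≤ κ * ‖star x ξ‖ ^ 2 := by
  wlog hx1 : ‖x‖ ≤ 1 generalizing x
  · have hx0 : 0 < ‖x‖ := by linarith
    have := this (x := ((‖x‖⁻¹ : ℝ) : ℂ) • x) (smul_mem _ hx) (by rw [smul_mul_assoc, hxg])
      (by rw [mul_smul_comm, hgx]) (by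
        rw [norm_smul, Complex.norm_real, norm_inv, norm_norm, inv_mul_cancel₀ hx0.ne'])
    rw [star_smul, smul_apply, smul_apply, norm_smul, norm_smul, norm_star, mul_pow, mul_pow,
      mul_left_comm] at this
    refine le_of_mul_le_mul_left this ?_
    rw [Complex.norm_real, norm_inv, norm_norm]
    positivity
  have key (n : ℕ) (hn : 0 < n) : ‖x ξ‖ ^ 2 ≤ κ * ‖star x ξ‖ ^ 2 + ‖ξ‖ ^ 2 * (n : ℝ)⁻¹ := by
    obtain ⟨v, hv, h1, -, h3⟩ := exists_layers hx hx1 hg hxg hgx hn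
    have k1 := re_inner_mono h1 ξ
    have k3 := re_inner_mono h3 ξ
    rw [re_inner_star_mul_self, re_inner_smul_sum] at k1
    have k4 := re_inner_smul_sum (Finset.range n) (n : ℝ)⁻¹ (fun k ↦ star (v (k + 1))) ξ
    have k5 := re_inner_star_mul_self (star x) ξ
    simp only [star_star] at k4 k5
    rw [k4, k5] at k3
    have hv0 : ‖v 0 ξ‖ ^ 2 ≤ ‖ξ‖ ^ 2 := by
      have hp := (hv 0).2.1.isStarProjection
      rw [← re_inner_star_mul_self, ← hp.star_mul_self, re_inner_star_mul_self]
      gcongr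
      exact (le_of_opNorm_le _ hp.norm_le ξ).trans (one_mul _).le
    -- Shifting the index by one costs only the term `v 0`, hence an error `‖ξ‖² / n`.
    have hsum : ∑ k ∈ Finset.range n, ‖v k ξ‖ ^ 2 ≤
        ‖ξ‖ ^ 2 + ∑ k ∈ Finset.range n, ‖v (k + 1) ξ‖ ^ 2 := by
      have h6 := Finset.sum_range_succ (fun k ↦ ‖v k ξ‖ ^ 2) n
      rw [Finset.sum_range_succ'] at h6
      nlinarith [sq_nonneg ‖v n ξ‖]
    have hterm : ∑ k ∈ Finset.range n, ‖v (k + 1) ξ‖ ^ 2 ≤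
        κ * ∑ k ∈ Finset.range n, ‖star (v (k + 1)) ξ‖ ^ 2 := by
      rw [Finset.mul_sum]
      exact Finset.sum_le_sum fun k _ ↦
        h _ (hv (k + 1)).1 (hv (k + 1)).2.1 (hv (k + 1)).2.2.1 (hv (k + 1)).2.2.2
    have hn0 : (0 : ℝ) ≤ (n : ℝ)⁻¹ := by positivity
    calc ‖x ξ‖ ^ 2 ≤ (n : ℝ)⁻¹ * (‖ξ‖ ^ 2 + κ * ∑ k ∈ Finset.range n, ‖star (v (k + 1)) ξ‖ ^ 2) :=
          k1.trans (mul_le_mul_of_nonneg_left (hsum.trans (by linarith)) hn0)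
      _ = κ * ((n : ℝ)⁻¹ * ∑ k ∈ Finset.range n, ‖star (v (k + 1)) ξ‖ ^ 2) + ‖ξ‖ ^ 2 * (n : ℝ)⁻¹ := by
          ring
      _ ≤ _ := by gcongr
  have hlim : Filter.Tendsto (fun n : ℕ ↦ κ * ‖star x ξ‖ ^ 2 + ‖ξ‖ ^ 2 * (n : ℝ)⁻¹) Filter.atTop
      (nhds (κ * ‖star x ξ‖ ^ 2 + ‖ξ‖ ^ 2 * 0)) :=
    (tendsto_inv_atTop_nhds_zero_nat.const_mul _).const_add _
  rw [mul_zero, add_zero] at hlim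
  exact ge_of_tendsto hlim (Filter.eventually_atTop.2 ⟨1, fun n hn ↦ key n hn⟩)

end VonNeumannAlgebra

end Homogeneous

/-! ### Existence and faithfulness of the trace on a finite factor. -/

section Trace

variable {H : Type*} [NormedAddCommGroup H] [InnerProductSpace ℂ H] [CompleteSpace H]

local notation "⟪" x ", " y "⟫" => inner ℂ x y

open ContinuousLinearMap

namespace VonNeumannAlgebra

variable {M : VonNeumannAlgebra H}

/-- A finite von Neumann algebra contains no infinite family of mutually orthogonal equivalent
nonzero projections. -/
theorem IsFinite.finite_of_pairwise_orthogonal (hfin : M.IsFinite) {g : H →L[ℂ] H}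
    (hg : IsStarProjection g) (hg0 : g ≠ 0) {s : Set (H →L[ℂ] H)}
    (hs : ∀ w ∈ s, w ∈ M ∧ w * star w = g) (hpw : s.Pairwise fun v w ↦ v * star w = 0) :
    s.Finite := by
  by_contra hinf
  let e := Set.Infinite.natEmbedding s hinf
  let w : ℕ → H →L[ℂ] H := fun n ↦ e n
  have hwM (n) : w n ∈ M := (hs _ (e n).2).1
  have hwg (n) : w n * star (w n) = g := (hs _ (e n).2).2
  have hPI (n) : IsPartialIsometry (w n) := by
    have : IsPartialIsometry (star (w n)) :=
      isPartialIsometry_of_isStarProjection (by rw [star_star, hwg]; exact hg)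
    simpa using this.star
  have horth (m n) (hmn : m ≠ n) : w m * star (w n) = 0 :=
    hpw (e m).2 (e n).2 fun h ↦ hmn (e.injective (Subtype.ext h))
  have hgw (n) : g * w n = w n := by rw [← hwg n]; exact hPI n
  -- A unilateral shift: `u n` carries the `n`-th initial projection to the next one, so the sum `U`
  -- misses the zeroth one in its range.
  let u : ℕ → H →L[ℂ] H := fun n ↦ star (w (n + 1)) * w n
  have hsu (n) : star (u n) = star (w n) * w (n + 1) := by simp [u]
  have huu (n) : star (u n) * u n = star (w n) * w n := by
    rw [hsu]
    calc star (w n) * w (n + 1) * (star (w (n + 1)) * w n)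
        = star (w n) * (w (n + 1) * star (w (n + 1)) * w n) := by simp only [mul_assoc]
      _ = _ := by rw [hwg, hgw]
  obtain ⟨U, hU, hUsum, h1, h2, -, -⟩ := exists_hasSum_partialIsometry (v := u)
    (fun n ↦ isPartialIsometry_of_isStarProjection (by
      rw [huu]; exact (hPI n).isStarProjection))
    (fun i j hij ↦ by
      rw [hsu]
      calc star (w (i + 1)) * w i * (star (w j) * w (j + 1))
          = star (w (i + 1)) * (w i * star (w j)) * w (j + 1) := by simp only [mul_assoc]
        _ = 0 := by rw [horth i j hij, mul_zero, zero_mul])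
    (fun i j hij ↦ by
      rw [hsu]
      calc star (w i) * w (i + 1) * (star (w (j + 1)) * w j)
          = star (w i) * (w (i + 1) * star (w (j + 1))) * w j := by simp only [mul_assoc]
        _ = 0 := by rw [horth _ _ (by omega), mul_zero, zero_mul])
  have hUM : U ∈ M := mem_of_hasSum hUsum fun n ↦ mul_mem (star_mem (hwM _)) (hwM n)
  have hQ (n) : star U * U * star (w n) = star (w n) := by
    have h3 : star U * u n = star (u n) * u n := by
      have := congrArg star (h1 n)
      simpa using this
    have h4 : star (w n) = star (u n) * u n * star (w n) := by
      rw [huu, mul_assoc, (hPI n).star_eq]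
    calc star U * U * star (w n) = star U * (U * star (u n)) * (u n * star (w n)) := by
          conv_lhs => rw [h4]
          simp only [mul_assoc]
      _ = (star U * u n) * (star (u n) * u n * star (w n)) := by rw [h2]; simp only [mul_assoc]
      _ = star (w n) := by rw [← h4, h3, ← h4]
  have hQU : star U * U * U = U := by
    have := mul_eq_mul_of_hasSum (T := star U * U) (S := 1) hUsum fun n ↦ by
      rw [mul_one, ← mul_assoc, hQ]
    rw [this, mul_one]
  have hfinal := hfin.mul_star_eq hUM hU.isStarProjection rfl hQU
  have h0U : w 0 * U = 0 := by
    have := mul_eq_mul_of_hasSum (T := w 0) (S := 0) hUsum fun n ↦ by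
      rw [mul_zero, ← mul_assoc, horth _ _ (by omega), zero_mul]
    rw [this, mul_zero]
  apply hg0
  -- Finiteness gives `U⋆U = UU⋆`; the first dominates the zeroth projection and the second is
  -- orthogonal to it.
  rw [← hwg 0, ← hQ 0, ← hfinal, ← mul_assoc, ← mul_assoc, h0U, zero_mul, zero_mul]

/-- In a finite factor the identity is a finite sum of projections equivalent to subprojections of
a given nonzero projection. -/
theorem IsFactor.exists_finite_cover (hM : M.IsFactor) (hfin : M.IsFinite) {g : H →L[ℂ] H}
    (hgM : g ∈ M) (hg : IsStarProjection g) (hg0 : g ≠ 0) :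
    ∃ (n : ℕ) (w : Fin n → H →L[ℂ] H), (∀ i, w i ∈ M ∧ IsPartialIsometry (w i) ∧ g * w i = w i) ∧
      ∑ i, star (w i) * w i = 1 := by
  let 𝒮 : Set (Set (H →L[ℂ] H)) :=
    {s | (∀ w ∈ s, w ∈ M ∧ w * star w = g) ∧ s.Pairwise fun v w ↦ v * star w = 0}
  obtain ⟨s, hs⟩ := zorn_subset 𝒮 fun C hC hchain ↦ by
    refine ⟨⋃₀ C, ⟨?_, ?_⟩, fun t ht ↦ Set.subset_sUnion_of_mem ht⟩
    · rintro v ⟨t, ht, hv⟩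
      exact (hC ht).1 v hv
    · exact (Set.pairwise_sUnion hchain.directedOn).2 fun t ht ↦ (hC ht).2
  have hs1 := hs.prop.1
  have hpw := hs.prop.2
  have hsfin := hfin.finite_of_pairwise_orthogonal hg hg0 hs1 hpw
  have := hsfin.fintype
  have hPI (w : s) : IsPartialIsometry (w : H →L[ℂ] H) := by
    have : IsPartialIsometry (star (w : H →L[ℂ] H)) :=
      isPartialIsometry_of_isStarProjection (by rw [star_star, (hs1 _ w.2).2]; exact hg)
    simpa using this.star
  set q := ∑ w : s, star (w : H →L[ℂ] H) * (w : H →L[ℂ] H) with hq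
  have hqproj : IsStarProjection q := by
    refine IsStarProjection.sum _ (fun w ↦ (hPI w).isStarProjection) (fun v w hvw ↦ ?_) _
    calc star (v : H →L[ℂ] H) * v * (star (w : H →L[ℂ] H) * w)
        = star (v : H →L[ℂ] H) * (v * star (w : H →L[ℂ] H)) * w := by simp only [mul_assoc]
      _ = 0 := by rw [hpw v.2 w.2 fun h ↦ hvw (Subtype.ext h), mul_zero, zero_mul]
  have hqM : q ∈ M := sum_mem fun w _ ↦ mul_mem (star_mem (hs1 _ w.2).1) (hs1 _ w.2).1
  have hqw (w : s) : q * star (w : H →L[ℂ] H) = star (w : H →L[ℂ] H) := by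
    rw [hq, Finset.sum_mul, Finset.sum_eq_single_of_mem w (Finset.mem_univ w), mul_assoc,
      (hPI w).star_eq]
    intro v _ hvw
    rw [mul_assoc, hpw v.2 w.2 fun h ↦ hvw (Subtype.ext h), mul_zero]
  -- The choice `ξ = 0`, `c = 0` makes the norm estimate vacuous, leaving pure comparison of the
  -- remainder `1 - q` with `g`.
  obtain ⟨V, hVM, hV, hVe, hgV, -, hmax⟩ := exists_maximal_partialIsometry
    (sub_mem (one_mem M) hqM) hgM hqproj.one_sub hg 0 0 fun e' f' heM hfM he hf _ _ he0 hf0 ↦ by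
      obtain ⟨v, hvM, hv, hv0, h1, h2⟩ := hM.exists_partialIsometry heM hfM he hf he0 hf0
      exact ⟨v, hvM, hv, hv0, h1, h2, by simp⟩
  have hVV : star V * V = 1 - q := by
    -- A remainder large enough to contain a copy of `g` would enlarge the maximal family.
    refine hmax.resolve_right fun hVg ↦ ?_
    have horth (w) (hw : w ∈ s) : V * star w = 0 := by
      rw [← hVe, mul_assoc, sub_mul, one_mul, hqw ⟨w, hw⟩, sub_self, mul_zero]
    have hVs : V ∈ s := by
      refine hs.le_of_ge (y := insert V s) ⟨?_, ?_⟩ (Set.subset_insert V s) (Set.mem_insert V s)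
      · rintro w (rfl | hw)
        · exact ⟨hVM, hVg⟩
        · exact hs1 w hw
      · refine hpw.insert fun w hw _ ↦ ⟨horth w hw, ?_⟩
        have := congrArg star (horth w hw); simpa using this
    exact hg0 (by rw [← hVg, horth V hVs])
  let W : Option s → H →L[ℂ] H := fun o ↦ o.elim V fun w ↦ w
  let e := Fintype.equivFin (Option s)
  refine ⟨_, W ∘ e.symm, fun i ↦ ?_, ?_⟩
  · simp only [Function.comp_apply]
    rcases e.symm i with _ | w
    · exact ⟨hVM, hV, hgV⟩
    · refine ⟨(hs1 _ w.2).1, hPI w, ?_⟩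
      change g * (w : H →L[ℂ] H) = w
      rw [← (hs1 _ w.2).2]
      exact hPI w
  · have := e.symm.sum_comp fun o ↦ star (W o) * W o
    simp only [Function.comp_apply]
    rw [this, Fintype.sum_option]
    change star V * V + q = 1
    rw [hVV, sub_add_cancel]

/-- A finite factor has positive normalized functionals that are tracial up to a factor `κ > 1`. -/
theorem IsFactor.exists_almost_trace (hM : M.IsFactor) (hfin : M.IsFinite) {κ : ℝ} (hκ : 1 < κ) :
    ∃ ψ : (H →L[ℂ] H) →L[ℂ] ℂ, ‖ψ‖ ≤ 1 ∧ ψ 1 = 1 ∧ (∀ x, 0 ≤ ψ (star x * x)) ∧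
      ∀ x ∈ M, (ψ (star x * x)).re ≤ κ * (ψ (x * star x)).re := by
  obtain ⟨ξ, hξ⟩ : ∃ ξ : H, ξ ≠ 0 := by
    by_contra! hcon
    exact hM.one_ne_zero (by ext ξ; rw [hcon ξ, map_zero, map_zero])
  obtain ⟨g, hgM, hg, hgξ, hb⟩ := hM.exists_projection_almost_tracial hfin hξ hκ
  have hb' {x : H →L[ℂ] H} (hx : x ∈ M) (hxg : x * g = x) (hgx : g * x = x) :=
    norm_sq_le_of_forall_partialIsometry hg (by linarith : 0 ≤ κ) hb hx hxg hgx
  have hg0 : g ≠ 0 := by rintro rfl; exact hgξ rfl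
  obtain ⟨n, w, hw, hsum⟩ := hM.exists_finite_cover hfin hgM hg hg0
  have hsw (i) : star (w i) * g = star (w i) := by
    have := congrArg star (hw i).2.2
    rwa [star_mul, hg.isSelfAdjoint.star_eq] at this
  let η : Fin n → H := fun i ↦ star (w i) ξ
  have hdecomp (ζ : H) : ‖ζ‖ ^ 2 = ∑ j, ‖w j ζ‖ ^ 2 := by
    have h1 : (⟪ζ, (1 : H →L[ℂ] H) ζ⟫).re = ‖ζ‖ ^ 2 := inner_self_eq_norm_sq (𝕜 := ℂ) ζ
    rw [← hsum, sum_apply, inner_sum, Complex.re_sum] at h1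
    simp_rw [re_inner_star_mul_self] at h1
    exact h1.symm
  set c : ℝ := ∑ i, ‖η i‖ ^ 2 with hc
  -- If all `star (w i) ξ` vanished, the corner estimate for `w j * g` would give `w j (g ξ) = 0`
  -- for every `j`, hence `g ξ = 0`.
  have hcpos : 0 < c := by
    rcases (Finset.sum_nonneg fun i _ ↦ by positivity : 0 ≤ c).lt_or_eq with h | h
    · exact h
    exfalso
    have h0 := (Finset.sum_eq_zero_iff_of_nonneg fun i _ ↦ by positivity).1 h.symm
    have h1 (j) : ‖w j (g ξ)‖ ^ 2 ≤ 0 := by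
      have h2 := hb' (x := w j * g) (mul_mem (hw j).1 hgM)
        (by rw [mul_assoc, hg.isIdempotentElem.eq]) (by rw [← mul_assoc, (hw j).2.2])
      rw [star_mul, hg.isSelfAdjoint.star_eq] at h2
      change ‖w j (g ξ)‖ ^ 2 ≤ κ * ‖g (star (w j) ξ)‖ ^ 2 at h2
      have h3 : star (w j) ξ = 0 := by
        have : ‖star (w j) ξ‖ ^ 2 = 0 := h0 j (Finset.mem_univ j)
        simpa using this
      rw [h3, map_zero] at h2
      simpa using h2
    have h4 := hdecomp (g ξ)
    have h5 : ∑ j, ‖w j (g ξ)‖ ^ 2 ≤ 0 := Finset.sum_nonpos fun j _ ↦ h1 j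
    have h6 : 0 < ‖g ξ‖ ^ 2 := by positivity
    linarith
  let ψ₀ : (H →L[ℂ] H) →L[ℂ] ℂ := ∑ i, innerSL ℂ (η i) ∘L ContinuousLinearMap.apply ℂ H (η i)
  have hψ₀ (x) : ψ₀ x = ∑ i, ⟪η i, x (η i)⟫ := by simp [ψ₀, sum_apply]
  have hψ₀s (x : H →L[ℂ] H) : ψ₀ (star x * x) = ((∑ i, ‖x (η i)‖ ^ 2 : ℝ) : ℂ) := by
    rw [hψ₀]; push_cast
    exact Finset.sum_congr rfl fun i _ ↦ inner_star_mul_self x (η i)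
  have hψ (x) : ((c⁻¹ : ℝ) • ψ₀) x = ((c⁻¹ : ℝ) : ℂ) * ψ₀ x := by
    rw [smul_apply, Complex.real_smul]
  refine ⟨(c⁻¹ : ℝ) • ψ₀, ?_, ?_, fun x ↦ ?_, fun x hx ↦ ?_⟩
  · refine opNorm_le_bound _ zero_le_one fun x ↦ ?_
    rw [hψ, hψ₀, norm_mul, Complex.norm_real, norm_inv, Real.norm_of_nonneg hcpos.le, one_mul,
      inv_mul_le_iff₀ hcpos, hc, Finset.sum_mul]
    refine (norm_sum_le _ _).trans (Finset.sum_le_sum fun i _ ↦ ?_)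
    calc ‖⟪η i, x (η i)⟫‖ ≤ ‖η i‖ * (‖x‖ * ‖η i‖) :=
          (norm_inner_le_norm _ _).trans (by gcongr; exact x.le_opNorm _)
      _ = ‖η i‖ ^ 2 * ‖x‖ := by ring
  · have := hψ₀s 1
    rw [star_one, one_mul] at this
    rw [hψ, this, ← Complex.ofReal_mul]
    change ((c⁻¹ * c : ℝ) : ℂ) = 1
    rw [inv_mul_cancel₀ hcpos.ne', Complex.ofReal_one]
  · rw [hψ, hψ₀s, ← Complex.ofReal_mul]
    exact_mod_cast mul_nonneg (inv_nonneg.2 hcpos.le) (Finset.sum_nonneg fun i _ ↦ by positivity)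
  · have hxx : x * star x = star (star x) * star x := by rw [star_star]
    rw [hψ, hψ, hxx, hψ₀s, hψ₀s, ← Complex.ofReal_mul, ← Complex.ofReal_mul, Complex.ofReal_re,
      Complex.ofReal_re, mul_left_comm]
    refine mul_le_mul_of_nonneg_left ?_ (inv_nonneg.2 hcpos.le)
    -- The matrix entries `w j * x * star (w i)` lie in the corner of `g`, where the estimate holds;
    -- taking adjoints transposes the matrix, so exchanging the sums reassembles `star x`.
    calc ∑ i, ‖x (η i)‖ ^ 2 = ∑ i, ∑ j, ‖(w j * x * star (w i)) ξ‖ ^ 2 :=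
          Finset.sum_congr rfl fun i _ ↦ hdecomp _
      _ ≤ ∑ i, ∑ j, κ * ‖star (w j * x * star (w i)) ξ‖ ^ 2 := by
          refine Finset.sum_le_sum fun i _ ↦ Finset.sum_le_sum fun j _ ↦ hb' ?_ ?_ ?_
          · exact mul_mem (mul_mem (hw j).1 hx) (star_mem (hw i).1)
          · rw [mul_assoc, hsw]
          · rw [← mul_assoc, ← mul_assoc, (hw j).2.2]
      _ = ∑ j, ∑ i, κ * ‖star (w j * x * star (w i)) ξ‖ ^ 2 := Finset.sum_comm
      _ = κ * ∑ j, ‖star x (η j)‖ ^ 2 := by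
          rw [Finset.mul_sum]
          refine Finset.sum_congr rfl fun j _ ↦ ?_
          rw [hdecomp (star x (η j)), Finset.mul_sum]
          refine Finset.sum_congr rfl fun i _ ↦ ?_
          rw [star_mul, star_mul, star_star]; rfl

/-- A finite factor has a tracial state. -/
theorem IsFactor.exists_trace (hM : M.IsFactor) (hfin : M.IsFinite) :
    ∃ τ : (H →L[ℂ] H) →L[ℂ] ℂ, τ 1 = 1 ∧ (∀ x, 0 ≤ τ (star x * x)) ∧
      ∀ x ∈ M, τ (star x * x) = τ (x * star x) := by
  have hκ (n : ℕ) : 1 < 1 + 1 / ((n : ℝ) + 1) := by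
    have : 0 < 1 / ((n : ℝ) + 1) := by positivity
    linarith
  choose ψ hn h1 hpos htr using fun n : ℕ ↦ hM.exists_almost_trace hfin (hκ n)
  let f : ℕ → WeakDual ℂ (H →L[ℂ] H) := fun n ↦ StrongDual.toWeakDual (ψ n)
  let U : Ultrafilter ℕ := Filter.hyperfilter ℕ
  obtain ⟨τ, -, hτ⟩ := (isCompact_iff_ultrafilter_le_nhds.1
    (WeakDual.isCompact_closedBall (0 : StrongDual ℂ (H →L[ℂ] H)) 1)) (U.map f) (by
      refine Filter.le_principal_iff.2 (Filter.mem_map.2 (Filter.univ_mem' fun n ↦ ?_))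
      simpa [f] using hn n)
  have hlim (x : H →L[ℂ] H) : Filter.Tendsto (fun n ↦ ψ n x) U (nhds (τ x)) :=
    ((WeakDual.eval_continuous x).tendsto τ).comp (show Filter.Tendsto f U (nhds τ) from hτ)
  have hposτ (x : H →L[ℂ] H) : 0 ≤ τ (star x * x) := ge_of_tendsto' (hlim _) fun n ↦ hpos n x
  have hle (x) (hx : x ∈ M) : (τ (star x * x)).re ≤ (τ (x * star x)).re := by
    have hU : Filter.Tendsto (fun n : ℕ ↦ 1 + 1 / ((n : ℝ) + 1)) U (nhds (1 + 0)) :=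
      (tendsto_one_div_add_atTop_nhds_zero_nat.mono_left Nat.hyperfilter_le_atTop).const_add 1
    have h2 := hU.mul ((Complex.continuous_re.tendsto _).comp (hlim (x * star x)))
    rw [add_zero, one_mul] at h2
    exact le_of_tendsto_of_tendsto' ((Complex.continuous_re.tendsto _).comp (hlim (star x * x))) h2
      fun n ↦ htr n x hx
  refine ⟨WeakDual.toStrongDual τ, ?_, hposτ, fun x hx ↦ ?_⟩
  · refine tendsto_nhds_unique (hlim 1) ?_
    simp_rw [h1]
    exact tendsto_const_nhds
  -- The one-sided inequality for `x` and for `star x` gives equality of real parts; positivity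
  -- makes the imaginary parts vanish.
  · have a1 := hle x hx
    have a2 := hle (star x) (star_mem hx)
    rw [star_star] at a2
    have p1 := hposτ x
    have p2 := hposτ (star x)
    rw [star_star] at p2
    refine Complex.ext (le_antisymm a1 a2) ?_
    exact (Complex.nonneg_iff.1 p1).2.symm.trans (Complex.nonneg_iff.1 p2).2

/-- Every tracial state on a finite factor is faithful. -/
theorem IsFactor.eq_zero_of_trace_eq_zero (hM : M.IsFactor) (hfin : M.IsFinite)
    {τ : (H →L[ℂ] H) →L[ℂ] ℂ} (h1 : τ 1 = 1) (hpos : ∀ x, 0 ≤ τ (star x * x))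
    (htr : ∀ x ∈ M, τ (star x * x) = τ (x * star x)) {x : H →L[ℂ] H} (hx : x ∈ M)
    (hx0 : τ (star x * x) = 0) : x = 0 := by
  wlog hx1 : ‖x‖ ≤ 1 generalizing x
  · have hx0 : 0 < ‖x‖ := by linarith
    have := this (x := ((‖x‖⁻¹ : ℝ) : ℂ) • x) (smul_mem _ hx) (by
        rw [star_smul, smul_mul_smul_comm, map_smul, ‹τ (star x * x) = 0›, smul_zero]) (by
        rw [norm_smul, Complex.norm_real, norm_inv, norm_norm, inv_mul_cancel₀ hx0.ne'])
    refine (smul_eq_zero.1 this).resolve_left ?_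
    exact_mod_cast inv_ne_zero hx0.ne'
  have hmono {S T : H →L[ℂ] H} (h : S ≤ T) : (τ S).re ≤ (τ T).re := by
    obtain ⟨y, hy⟩ := (CStarAlgebra.nonneg_iff_eq_star_mul_self).1 (sub_nonneg.2 h)
    have := hpos y
    rw [← hy, map_sub] at this
    have := (Complex.nonneg_iff.1 this).1
    rw [Complex.sub_re] at this
    linarith
  -- For `v ≠ 0`, cover `1` by projections equivalent to subprojections of `v⋆v`; a null `v⋆v` would
  -- force `τ 1` to be at most `0`.
  have hzero (v) (hvM : v ∈ M) (hv : IsPartialIsometry v) (hτv : (τ (star v * v)).re = 0) :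
      v = 0 := by
    by_contra hv0
    have hgproj := hv.isStarProjection
    obtain ⟨n, w, hw, hsum⟩ := hM.exists_finite_cover hfin (mul_mem (star_mem hvM) hvM) hgproj
      (by rw [Ne, CStarRing.star_mul_self_eq_zero_iff]; exact hv0)
    have hle (i) : w i * star (w i) ≤ star v * v :=
      ((hw i).2.1.isStarProjection'.le_iff_mul_eq_right hgproj).2 (by rw [← mul_assoc, (hw i).2.2])
    have h2 : (τ 1).re ≤ 0 := by
      rw [← hsum, map_sum, Complex.re_sum]
      refine Finset.sum_nonpos fun i _ ↦ ?_
      rw [htr _ (hw i).1, ← hτv]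
      exact hmono (hle i)
    rw [h1] at h2
    norm_num at h2
  have key (n : ℕ) (hn : 0 < n) (ζ : H) : ‖x ζ‖ ^ 2 ≤ ‖ζ‖ ^ 2 * (n : ℝ)⁻¹ := by
    obtain ⟨v, hv, h2, h3, -⟩ := exists_layers hx hx1 (IsStarProjection.one _) (mul_one x)
      (one_mul x) hn
    -- The shifted layers lie below `x⋆x`, hence are null and vanish. Only the layer `v 0`, of
    -- weight `1 / n`, remains in the upper bound.
    have hvz (k) (hk : k ∈ Finset.range n) : v (k + 1) = 0 := by
      refine hzero _ (hv _).1 (hv _).2.1 ?_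
      have h4 := hmono h3
      rw [hx0, ← Complex.coe_smul, map_smul, map_sum, Complex.coe_smul, Complex.smul_re,
        Complex.re_sum, Complex.zero_re, smul_eq_mul, inv_mul_le_iff₀ (by positivity),
        mul_zero] at h4
      have h5 (k : ℕ) : 0 ≤ (τ (star (v (k + 1)) * v (k + 1))).re := (Complex.nonneg_iff.1 (hpos _)).1
      exact (Finset.sum_eq_zero_iff_of_nonneg fun k _ ↦ h5 k).1
        (le_antisymm h4 (Finset.sum_nonneg fun k _ ↦ h5 k)) k hk
    have h6 := re_inner_mono h2 ζ
    rw [re_inner_star_mul_self, re_inner_smul_sum] at h6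
    have h7 : ∑ k ∈ Finset.range n, ‖v k ζ‖ ^ 2 ≤ ‖v 0 ζ‖ ^ 2 := by
      have h8 := Finset.sum_range_succ (fun k ↦ ‖v k ζ‖ ^ 2) n
      rw [Finset.sum_range_succ', Finset.sum_eq_zero fun k hk ↦ by rw [hvz k hk]; simp,
        zero_add] at h8
      nlinarith [sq_nonneg ‖v n ζ‖]
    have hv0 : ‖v 0 ζ‖ ^ 2 ≤ ‖ζ‖ ^ 2 := by
      have hp := (hv 0).2.1.isStarProjection
      rw [← re_inner_star_mul_self, ← hp.star_mul_self, re_inner_star_mul_self]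
      gcongr
      exact (le_of_opNorm_le _ hp.norm_le ζ).trans (one_mul _).le
    rw [mul_comm]
    exact h6.trans (mul_le_mul_of_nonneg_left (h7.trans hv0) (by positivity))
  ext ζ
  have hlim : Filter.Tendsto (fun n : ℕ ↦ ‖ζ‖ ^ 2 * (n : ℝ)⁻¹) Filter.atTop
      (nhds (‖ζ‖ ^ 2 * 0)) := tendsto_inv_atTop_nhds_zero_nat.const_mul _
  rw [mul_zero] at hlim
  have h9 : ‖x ζ‖ ^ 2 ≤ 0 :=
    ge_of_tendsto hlim (Filter.eventually_atTop.2 ⟨1, fun n hn ↦ key n hn ζ⟩)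
  have h10 : ‖x ζ‖ = 0 := by nlinarith [norm_nonneg (x ζ)]
  simpa using h10

end VonNeumannAlgebra

end Trace

/-- A unital C⋆-algebra that embeds into a finite factor has a faithful tracial state. -/
theorem exists_faithful_tracialState_of_injective {A : Type*} [CStarAlgebra A]
    {H : Type*} [NormedAddCommGroup H] [InnerProductSpace ℂ H] [CompleteSpace H]
    {M : VonNeumannAlgebra H} (hM : M.IsFactor) (hfin : M.IsFinite)
    (φ : A →⋆ₐ[ℂ] M.toStarSubalgebra) (hφ : Function.Injective φ) :
    ∃ τ : A →L[ℂ] ℂ, IsTracialState τ ∧ IsFaithfulFunctional τ := by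
  obtain ⟨τ, h1, hpos, htr⟩ := hM.exists_trace hfin
  let ψ : A →⋆ₐ[ℂ] (H →L[ℂ] H) := M.toStarSubalgebra.subtype.comp φ
  have hψM (a : A) : ψ a ∈ M := (φ a).2
  have hψ : Function.Injective ψ := Subtype.val_injective.comp hφ
  let Ψ : A →L[ℂ] (H →L[ℂ] H) :=
    (ψ : A →ₗ[ℂ] (H →L[ℂ] H)).mkContinuous 1 fun a ↦ by
      rw [one_mul]; exact NonUnitalStarAlgHom.norm_apply_le ψ a
  have hΨ (a : A) : (τ ∘L Ψ) a = τ (ψ a) := rfl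
  refine ⟨τ ∘L Ψ, ⟨fun x ↦ ?_, ?_, fun x ↦ ?_⟩, fun x hx ↦ ?_⟩
  · rw [hΨ, map_mul, map_star]; exact hpos _
  · rw [hΨ, map_one, h1]
  · rw [hΨ, hΨ, map_mul ψ, map_mul ψ, map_star]; exact htr _ (hψM x)
  · rw [hΨ, map_mul, map_star] at hx
    exact hψ (by rw [map_zero]; exact hM.eq_zero_of_trace_eq_zero hfin h1 hpos htr (hψM x) hx)

/-! ### Hilbert spaces of positive semidefinite kernels. -/

section KernelSpace

/-- Every positive semidefinite kernel is the Gram matrix of a total family in a Hilbert space. -/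
theorem exists_total_of_posSemidef {X : Type u} {k : Matrix X X ℂ} (hk : k.PosSemidef) :
    ∃ (H : Type u) (_ : NormedAddCommGroup H) (_ : InnerProductSpace ℂ H) (_ : CompleteSpace H)
      (Λ : X → H), (∀ x y, inner ℂ (Λ x) (Λ y) = k x y) ∧
        (Submodule.span ℂ (Set.range Λ)).topologicalClosure = ⊤ := by
  let K : Matrix X X (ℂ →L[ℂ] ℂ) := Matrix.of fun x y ↦ k x y • (1 : ℂ →L[ℂ] ℂ)
  have hKa (x y : X) (w : ℂ) : K x y w = k x y * w := rfl
  have hherm (x y : X) : star (k x y) = k y x := hk.1.apply y x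
  have hK : K.PosSemidef := by
    have htfae : K.PosSemidef ↔ K.IsHermitian ∧ ∀ vv : X →₀ ℂ, 0 ≤ RCLike.re
        (vv.sum fun x w ↦ vv.sum fun x' w' ↦ inner ℂ (K x' x w) w') :=
      RKHS.posSemidef_tfae.out 0 2
    refine htfae.2 ⟨?_, fun vv ↦ ?_⟩
    · ext x y
      simp [K, Matrix.conjTranspose_apply, ← hherm y x]
    · have h := (Complex.nonneg_iff.1 (hk.2 vv)).1
      convert h using 1
      change Complex.re _ = _
      congr 1
      refine Finset.sum_congr rfl fun x _ ↦ Finset.sum_congr rfl fun x' _ ↦ ?_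
      dsimp only
      rw [hKa, RCLike.inner_apply, map_mul]
      have := hherm x' x
      simp only [RCLike.star_def] at this ⊢
      rw [this]; ring
  have : Fact K.PosSemidef := ⟨hK⟩
  refine ⟨RKHS.OfKernel K, inferInstance, inferInstance, inferInstance,
    fun x ↦ RKHS.kerFun (RKHS.OfKernel K) x 1, fun x y ↦ ?_, ?_⟩
  · rw [← RKHS.kernel_inner, RKHS.OfKernel.kernel_ofKernel, hKa, RCLike.inner_apply, mul_one,
      one_mul]
    exact hherm y x
  · rw [← RKHS.kerFun_dense (RKHS.OfKernel K)]
    congr 1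
    refine le_antisymm (Submodule.span_mono ?_) (Submodule.span_le.2 ?_)
    · rintro _ ⟨x, rfl⟩
      exact ⟨x, 1, rfl⟩
    · rintro _ ⟨x, v, rfl⟩
      have : RKHS.kerFun (RKHS.OfKernel K) x v = v • RKHS.kerFun (RKHS.OfKernel K) x 1 := by
        rw [← map_smul, smul_eq_mul, mul_one]
      rw [this]
      exact Submodule.smul_mem _ _ (Submodule.subset_span ⟨x, rfl⟩)

end KernelSpace

/-! ### The regular representation of a positive definite class function. -/

section CharacterRep

open ContinuousLinearMap

/-- The two-sided regular representation of a group on the Hilbert space of a character `χ`. -/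
structure CharacterRep (Γ : Type*) [Group Γ] (χ : Γ → ℂ) (H : Type*) [NormedAddCommGroup H]
    [InnerProductSpace ℂ H] [CompleteSpace H] where
  /-- the vectors implementing the character -/
  vec : Γ → H
  inner_vec : ∀ g h, inner ℂ (vec g) (vec h) = χ (g⁻¹ * h)
  dense : (Submodule.span ℂ (Set.range vec)).topologicalClosure = ⊤
  /-- the action by left and right translations -/
  act : Γ × Γ →* (H →L[ℂ] H)
  act_vec : ∀ a b g, act (a, b) (vec g) = vec (a * g * b⁻¹)
  star_act : ∀ p, star (act p) = act p⁻¹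

variable {Γ : Type*} [Group Γ] {χ : Γ → ℂ} {H : Type*} [NormedAddCommGroup H]
    [InnerProductSpace ℂ H] [CompleteSpace H]

local notation "⟪" x ", " y "⟫" => inner ℂ x y

theorem eq_of_forall_apply_eq_of_dense {X : Type*} {v : X → H}
    (hv : (Submodule.span ℂ (Set.range v)).topologicalClosure = ⊤) {S T : H →L[ℂ] H}
    (h : ∀ x, S (v x) = T (v x)) : S = T := by
  refine ContinuousLinearMap.ext_on (s := Set.range v) ?_ ?_
  · rw [← Submodule.dense_iff_topologicalClosure_eq_top] at hv; exact hv
  · rintro _ ⟨x, rfl⟩; exact h x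

/-- Two-sided translations preserve the Gram matrix because `χ` is a class function, so they extend
to isometries. Multiplicativity, checked on the total family, makes these unitary. -/
theorem exists_characterRep {Γ : Type u} [Group Γ] {χ : Γ → ℂ}
    (hχ : (Matrix.of fun g h ↦ χ (g⁻¹ * h) : Matrix Γ Γ ℂ).PosSemidef)
    (hconj : ∀ k g, χ (k * g * k⁻¹) = χ g) :
    ∃ (H : Type u) (_ : NormedAddCommGroup H) (_ : InnerProductSpace ℂ H) (_ : CompleteSpace H),
      Nonempty (CharacterRep Γ χ H) := by
  obtain ⟨H, _, _, _, Λ, hΛ, hd⟩ := exists_total_of_posSemidef hχ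
  have htrans (p : Γ × Γ) : ∃ V : H →L[ℂ] H, (∀ g, V (Λ g) = Λ (p.1 * g * p.2⁻¹)) ∧
      star V * V = 1 := by
    obtain ⟨V, hV, hVV⟩ := exists_partial_isometry_of_gram_eq (v := Λ)
      (w := fun g ↦ Λ (p.1 * g * p.2⁻¹)) fun g h ↦ by
        rw [hΛ, hΛ, Matrix.of_apply, Matrix.of_apply, ← hconj p.2 (g⁻¹ * h)]
        congr 1; group
    refine ⟨V, hV, ?_⟩
    rw [hVV]
    ext ξ
    exact Submodule.starProjection_eq_self_iff.2 (hd ▸ trivial)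
  choose T hT hTT using htrans
  have hmul (p q) : T (p * q) = T p * T q := eq_of_forall_apply_eq_of_dense hd fun g ↦ by
    change _ = T p (T q (Λ g))
    rw [hT, hT, hT]
    simp only [Prod.fst_mul, Prod.snd_mul]
    congr 1; group
  have hone : T 1 = 1 := eq_of_forall_apply_eq_of_dense hd fun g ↦ by
    rw [hT]; simp
  refine ⟨H, inferInstance, inferInstance, inferInstance, ⟨
    { vec := Λ
      inner_vec := hΛ
      dense := hd
      act := { toFun := T, map_one' := hone, map_mul' := hmul }
      act_vec := fun a b g ↦ hT (a, b) g
      star_act := fun p ↦ ?_ }⟩⟩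
  change star (T p) = T p⁻¹
  calc star (T p) = star (T p) * (T p * T p⁻¹) := by rw [← hmul, mul_inv_cancel, hone, mul_one]
    _ = T p⁻¹ := by rw [← mul_assoc, hTT, one_mul]

namespace CharacterRep

variable (R : CharacterRep Γ χ H)

theorem ext_vec {S T : H →L[ℂ] H} (h : ∀ g, S (R.vec g) = T (R.vec g)) : S = T :=
  eq_of_forall_apply_eq_of_dense R.dense h

theorem act_mul_star (p : Γ × Γ) : star (R.act p) * R.act p = 1 := by
  rw [R.star_act, ← map_mul, inv_mul_cancel, map_one]

theorem norm_act (p : Γ × Γ) (ξ : H) : ‖R.act p ξ‖ = ‖ξ‖ :=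
  norm_apply_eq_of_star_mul_self_eq (b := 1) (by rw [R.act_mul_star, star_one, one_mul]) ξ

theorem act_apply_act (p q : Γ × Γ) (ξ : H) : R.act p (R.act q ξ) = R.act (p * q) ξ := by
  rw [map_mul]; rfl

theorem act_vec_one (k : Γ) : R.act (k, k) (R.vec 1) = R.vec 1 := by
  rw [R.act_vec, mul_one, mul_inv_cancel]

theorem act_one_vec_one (g : Γ) : R.act (1, g⁻¹) (R.vec 1) = R.vec g := by
  rw [R.act_vec, one_mul, one_mul, inv_inv]

/-- Finite linear combinations of the vectors of the representation. -/
noncomputable def comb (a : Γ →₀ ℂ) : H := Finsupp.linearCombination ℂ R.vec a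

theorem inner_comb (a b : Γ →₀ ℂ) : ⟪R.comb a, R.comb b⟫ =
    a.sum fun g z ↦ b.sum fun h w ↦ star z * w * χ (g⁻¹ * h) := by
  simp only [comb, Finsupp.linearCombination_apply, Finsupp.sum, sum_inner, inner_sum,
    inner_smul_left, inner_smul_right, R.inner_vec, Finset.mul_sum]
  rw [Finset.sum_comm]
  refine Finset.sum_congr rfl fun g _ ↦ Finset.sum_congr rfl fun h _ ↦ ?_
  simp only [RCLike.star_def]; ring

theorem dense_comb : DenseRange R.comb := by
  have h := (Submodule.dense_iff_topologicalClosure_eq_top).2 R.dense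
  rw [← Finsupp.range_linearCombination] at h
  exact h

/-- The von Neumann algebra generated by the left translations, defined as the commutant of the
right translations. -/
noncomputable def vonNeumannAlgebra : VonNeumannAlgebra H where
  toStarSubalgebra := StarSubalgebra.centralizer ℂ (Set.range fun b ↦ R.act (1, b))
  centralizer_centralizer' := by simp

theorem mem_vonNeumannAlgebra {x : H →L[ℂ] H} :
    x ∈ R.vonNeumannAlgebra ↔ ∀ b, R.act (1, b) * x = x * R.act (1, b) := by
  change x ∈ StarSubalgebra.centralizer ℂ (Set.range fun b ↦ R.act (1, b)) ↔ _
  rw [StarSubalgebra.mem_centralizer_iff]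
  constructor
  · exact fun h b ↦ (h _ ⟨b, rfl⟩).1
  · rintro h _ ⟨b, rfl⟩
    refine ⟨h b, ?_⟩
    rw [R.star_act]
    simpa using h b⁻¹

theorem act_left_mem (a : Γ) : R.act (a, 1) ∈ R.vonNeumannAlgebra :=
  R.mem_vonNeumannAlgebra.2 fun b ↦ by rw [← map_mul, ← map_mul]; simp

variable {R}

theorem apply_act {x : H →L[ℂ] H} (hx : x ∈ R.vonNeumannAlgebra) (b : Γ) (ξ : H) :
    x (R.act (1, b) ξ) = R.act (1, b) (x ξ) :=
  (DFunLike.congr_fun (R.mem_vonNeumannAlgebra.1 hx b) ξ).symm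

/-- The vector at `1` is separating: right translations commute with `x` and carry that vector to
the total family. -/
theorem eq_zero_of_apply_vec_one {x : H →L[ℂ] H} (hx : x ∈ R.vonNeumannAlgebra)
    (h : x (R.vec 1) = 0) : x = 0 :=
  R.ext_vec fun g ↦ by rw [← R.act_one_vec_one, apply_act hx, h, map_zero]; rfl

/-- The antilinear map `vec g ↦ vec g⁻¹` is isometric for a class function and exchanges the
coefficients of `x (vec 1)` and `star x (vec 1)`. Applied with `star x` as well, this makes `vec 1`
a trace vector. -/
theorem norm_star_apply_le (hconj : ∀ k g, χ (k * g * k⁻¹) = χ g) {x : H →L[ℂ] H}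
    (hx : x ∈ R.vonNeumannAlgebra) : ‖star x (R.vec 1)‖ ≤ ‖x (R.vec 1)‖ := by
  have hcoef (g : Γ) : ⟪R.vec g, star x (R.vec 1)⟫ = star ⟪R.vec g⁻¹, x (R.vec 1)⟫ := by
    rw [inner_star_right, ← R.act_one_vec_one g, apply_act hx]
    rw [← inner_star_right, R.star_act, ← R.act_one_vec_one g⁻¹]
    simp only [Prod.inv_mk, inv_one, inv_inv]
    exact (inner_conj_symm _ _).symm
  have key (a : Γ →₀ ℂ) : ‖⟪R.comb a, star x (R.vec 1)⟫‖ ≤ ‖R.comb a‖ * ‖x (R.vec 1)‖ := by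
    -- The image of `R.comb a` under this antilinear isometry.
    set b : H := a.sum fun g z ↦ star z • R.vec g⁻¹ with hb
    have h1 : ⟪R.comb a, star x (R.vec 1)⟫ = star ⟪b, x (R.vec 1)⟫ := by
      rw [hb, comb, Finsupp.linearCombination_apply, Finsupp.sum_inner, Finsupp.sum_inner,
        Finsupp.sum, Finsupp.sum, star_sum]
      refine Finset.sum_congr rfl fun g _ ↦ ?_
      rw [inner_smul_left, inner_smul_left, hcoef, star_mul']; simp
    have h2 : ⟪b, b⟫ = ⟪R.comb a, R.comb a⟫ := by
      rw [R.inner_comb, hb]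
      simp only [Finsupp.sum, sum_inner, inner_sum, inner_smul_left, inner_smul_right, R.inner_vec,
        Finset.mul_sum]
      refine Finset.sum_congr rfl fun g _ ↦ Finset.sum_congr rfl fun h _ ↦ ?_
      rw [← hconj g⁻¹ (h⁻¹⁻¹ * g⁻¹)]
      simp only [RCLike.star_def, Complex.conj_conj]
      rw [show g⁻¹ * (h⁻¹⁻¹ * g⁻¹) * g⁻¹⁻¹ = g⁻¹ * h by group]
      ring
    have h3 : ‖b‖ = ‖R.comb a‖ := by
      rw [@norm_eq_sqrt_re_inner ℂ, @norm_eq_sqrt_re_inner ℂ, h2]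
    rw [h1, norm_star, ← h3]
    exact norm_inner_le_norm _ _
  have hall (ξ : H) : ‖⟪ξ, star x (R.vec 1)⟫‖ ≤ ‖ξ‖ * ‖x (R.vec 1)‖ :=
    R.dense_comb.induction_on (p := fun ξ ↦ ‖⟪ξ, star x (R.vec 1)⟫‖ ≤ ‖ξ‖ * ‖x (R.vec 1)‖) ξ
      (isClosed_le (by fun_prop) (by fun_prop)) key
  have h := hall (star x (R.vec 1))
  rw [inner_self_eq_norm_sq_to_K] at h
  by_contra! hlt
  have hpos : 0 < ‖star x (R.vec 1)‖ := lt_of_le_of_lt (norm_nonneg _) hlt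
  simp only [norm_pow, RCLike.norm_ofReal, abs_norm] at h
  nlinarith

end CharacterRep

end CharacterRep

/-! ### Mixing characters give II₁ factors. -/

section MixingCharacter

open ContinuousLinearMap

/-- A normalized class function on a noncommutative group that is mixing: every finite set can be
conjugated into a commuting, independent position. -/
structure IsMixingCharacter {Γ : Type*} [Group Γ] (χ : Γ → ℂ) : Prop where
  one : χ 1 = 1
  conj : ∀ k g, χ (k * g * k⁻¹) = χ g
  mixing : ∀ F : Finset Γ, ∃ k, ∀ g ∈ F, ∀ h ∈ F,
    Commute h (k * g * k⁻¹) ∧ χ (h * (k * g * k⁻¹)) = χ h * χ g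
  noncomm : ∃ a b, (χ (a * b * (b * a)⁻¹)).re < 1

variable {Γ : Type*} [Group Γ] {χ : Γ → ℂ} {H : Type*} [NormedAddCommGroup H]
    [InnerProductSpace ℂ H] [CompleteSpace H]

local notation "⟪" x ", " y "⟫" => inner ℂ x y

namespace CharacterRep

variable {R : CharacterRep Γ χ H}

theorem norm_vec_one (hχ : IsMixingCharacter χ) : ‖R.vec 1‖ = 1 := by
  have h := R.inner_vec 1 1
  rw [inv_one, one_mul, hχ.one, inner_self_eq_norm_sq_to_K] at h
  have h' : ‖R.vec 1‖ ^ 2 = 1 := Complex.ofReal_injective (by push_cast; exact h)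
  nlinarith [norm_nonneg (R.vec 1)]

theorem norm_star_apply (hχ : IsMixingCharacter χ) {x : H →L[ℂ] H}
    (hx : x ∈ R.vonNeumannAlgebra) : ‖star x (R.vec 1)‖ = ‖x (R.vec 1)‖ := by
  refine le_antisymm (norm_star_apply_le hχ.conj hx) ?_
  simpa using norm_star_apply_le hχ.conj (star_mem hx)

/-- For an isometry `v` the trace vector has the same norm under `v` and `star v`, so the projection
`1 - v * star v` kills a separating vector. -/
theorem isFinite (hχ : IsMixingCharacter χ) : R.vonNeumannAlgebra.IsFinite := by
  rintro q hqM hq ⟨v, hvM, hv1, rfl⟩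
  have h1 : ‖v (R.vec 1)‖ = ‖R.vec 1‖ :=
    norm_apply_eq_of_star_mul_self_eq (b := 1) (by rw [hv1, star_one, one_mul]) _
  have h2 := norm_star_apply hχ hvM
  have hp := hq.one_sub
  have h3 := re_inner_star_mul_self (1 - v * star v) (R.vec 1)
  have h4 := re_inner_star_mul_self (star v) (R.vec 1)
  rw [hp.star_mul_self, sub_apply, inner_sub_right, Complex.sub_re] at h3
  rw [star_star, h2, h1] at h4
  have h5 : (⟪R.vec 1, (1 : H →L[ℂ] H) (R.vec 1)⟫).re = ‖R.vec 1‖ ^ 2 :=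
    inner_self_eq_norm_sq (𝕜 := ℂ) _
  rw [h4, h5, sub_self] at h3
  have h6 : (1 - v * star v) (R.vec 1) = 0 := by
    have := pow_eq_zero_iff (two_ne_zero) |>.1 h3.symm
    simpa using this
  have := eq_zero_of_apply_vec_one (R := R) (sub_mem (one_mem _) hqM) h6
  exact (sub_eq_zero.1 this).symm

theorem inner_vec_one_comb (a : Γ →₀ ℂ) :
    ⟪R.vec 1, R.comb a⟫ = ∑ g ∈ a.support, a g * χ g := by
  simp [comb, Finsupp.linearCombination_apply, Finsupp.sum, R.inner_vec]

theorem inner_comb_vec_one (a : Γ →₀ ℂ) :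
    ⟪R.comb a, R.vec 1⟫ = ∑ g ∈ a.support, star (a g) * χ g⁻¹ := by
  simp [comb, Finsupp.linearCombination_apply, Finsupp.sum, R.inner_vec, mul_comm]

theorem inner_comb_act_comb (a : Γ →₀ ℂ) (p : Γ × Γ) : ⟪R.comb a, R.act p (R.comb a)⟫ =
    ∑ g ∈ a.support, ∑ h ∈ a.support, star (a g) * a h * χ (g⁻¹ * (p.1 * h * p.2⁻¹)) := by
  obtain ⟨p, q⟩ := p
  simp only [comb, Finsupp.linearCombination_apply, Finsupp.sum, map_sum, map_smul, R.act_vec,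
    sum_inner, inner_sum, inner_smul_left, inner_smul_right, R.inner_vec, Finset.mul_sum]
  rw [Finset.sum_comm]
  refine Finset.sum_congr rfl fun g _ ↦ Finset.sum_congr rfl fun h _ ↦ ?_
  simp only [RCLike.star_def]; ring

/-- Conjugation by `k` decorrelates a given finite combination from itself, and turns `h` into an
element whose left and inverse right translations agree on that combination. -/
theorem exists_mixing (hχ : IsMixingCharacter χ) (a : Γ →₀ ℂ) (F : Finset Γ) :
    ∃ k : Γ, ⟪R.comb a, R.act (k, k) (R.comb a)⟫ = ⟪R.comb a, R.vec 1⟫ * ⟪R.vec 1, R.comb a⟫ ∧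
      ∀ h ∈ F, R.act (k * h * k⁻¹, 1) (R.comb a) = R.act (1, (k * h * k⁻¹)⁻¹) (R.comb a) ∧
        ⟪R.comb a, R.act (1, k * h * k⁻¹) (R.comb a)⟫ = χ h⁻¹ * ⟪R.comb a, R.comb a⟫ := by
  classical
  -- Inverses and the quotients `g⁻¹ * g'` are included because they occur as arguments of `χ` in
  -- the inner products.
  obtain ⟨k, hk⟩ := hχ.mixing (a.support ∪ a.support.image (fun g ↦ g⁻¹) ∪ F ∪
    F.image (fun g ↦ g⁻¹) ∪ (a.support ×ˢ a.support).image fun p ↦ p.1⁻¹ * p.2)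
  refine ⟨k, ?_, fun h hh ↦ ⟨?_, ?_⟩⟩
  · rw [inner_comb_act_comb, inner_comb_vec_one, inner_vec_one_comb, Finset.sum_mul_sum]
    refine Finset.sum_congr rfl fun g hg ↦ Finset.sum_congr rfl fun h hh ↦ ?_
    rw [(hk h (by simp [Finsupp.mem_support_iff.1 hh]) g⁻¹ (by
      simp [Finsupp.mem_support_iff.1 hg])).2]
    ring
  · simp only [comb, Finsupp.linearCombination_apply, Finsupp.sum, map_sum, map_smul, R.act_vec]
    refine Finset.sum_congr rfl fun g hg ↦ ?_
    rw [inv_inv, inv_one, mul_one, one_mul,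
      (hk h (by simp [hh]) g (by simp [Finsupp.mem_support_iff.1 hg])).1.eq]
  · have h1 := inner_comb_act_comb (R := R) a 1
    rw [map_one] at h1
    rw [inner_comb_act_comb]
    change _ = _ * ⟪R.comb a, (1 : H →L[ℂ] H) (R.comb a)⟫
    rw [h1, Finset.mul_sum]
    refine Finset.sum_congr rfl fun g hg ↦ ?_
    rw [Finset.mul_sum]
    refine Finset.sum_congr rfl fun g' hg' ↦ ?_
    have h2 := (hk h⁻¹ (by simp [hh]) (g⁻¹ * g') (by
      simp only [Finset.mem_union, Finset.mem_image, Finset.mem_product]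
      exact Or.inr ⟨(g, g'), ⟨hg, hg'⟩, rfl⟩)).2
    simp only [Prod.fst_one, Prod.snd_one, inv_one, one_mul, mul_one]
    rw [show g⁻¹ * (g' * (k * h * k⁻¹)⁻¹) = g⁻¹ * g' * (k * h⁻¹ * k⁻¹) by group, h2]
    ring

/-- For central `z`, the component `ζ` of `z (vec 1)` orthogonal to `vec 1` is fixed by conjugation.
Approximating it by a finite combination and conjugating by a mixing `k`, `⟪ζ, ζ⟫` is close to
`|⟪vec 1, ζ⟫|² = 0`. -/
theorem isFactor (hχ : IsMixingCharacter χ) : R.vonNeumannAlgebra.IsFactor where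
  one_ne_zero h := by
    have h1 := congrArg (fun T : H →L[ℂ] H ↦ ‖T (R.vec 1)‖) h
    simp [norm_vec_one hχ] at h1
  center z hz hz' := by
    refine ⟨⟪R.vec 1, z (R.vec 1)⟫, ?_⟩
    set c := ⟪R.vec 1, z (R.vec 1)⟫ with hc
    set ζ := z (R.vec 1) - c • R.vec 1 with hζ
    have hinv (k : Γ) : R.act (k, k) ζ = ζ := by
      have h1 : R.act (k, k) = R.act (k, 1) * R.act (1, k) := by rw [← map_mul]; simp
      have h2 : R.act (k, k) (z (R.vec 1)) = z (R.act (k, k) (R.vec 1)) := by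
        rw [h1]
        change R.act (k, 1) (R.act (1, k) (z (R.vec 1))) = z (R.act (k, 1) (R.act (1, k) (R.vec 1)))
        rw [← apply_act hz]
        exact DFunLike.congr_fun (VonNeumannAlgebra.mem_commutant_iff.1 hz' _ (R.act_left_mem k)) _
      rw [hζ, map_sub, map_smul, h2, R.act_vec_one]
    have horth : ⟪R.vec 1, ζ⟫ = 0 := by
      rw [hζ, inner_sub_right, inner_smul_right, inner_self_eq_norm_sq_to_K, norm_vec_one hχ]
      simp [hc]
    clear_value ζ
    have key (a : Γ →₀ ℂ) :
        ‖ζ‖ ^ 2 ≤ 2 * ‖ζ - R.comb a‖ * (‖ζ‖ + ‖ζ - R.comb a‖) := by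
      set δ := ‖ζ - R.comb a‖ with hδ
      obtain ⟨k, hk, -⟩ := exists_mixing (R := R) hχ a ∅
      have h1 : ‖⟪R.vec 1, R.comb a⟫‖ ≤ δ := by
        have : ⟪R.vec 1, R.comb a⟫ = - ⟪R.vec 1, ζ - R.comb a⟫ := by
          rw [inner_sub_right, horth, zero_sub, neg_neg]
        rw [this, norm_neg]
        exact (norm_inner_le_norm _ _).trans (by rw [norm_vec_one hχ, one_mul])
      have h1' : ‖⟪R.comb a, R.vec 1⟫‖ ≤ δ := by rw [norm_inner_symm]; exact h1
      have h2 : ‖R.comb a‖ ≤ ‖ζ‖ + δ := by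
        have : R.comb a = ζ - (ζ - R.comb a) := by abel
        rw [this]
        exact norm_sub_le _ _
      have h3 : ⟪ζ, ζ⟫ = ⟪ζ - R.comb a, ζ⟫ + ⟪R.comb a, R.act (k, k) (ζ - R.comb a)⟫ +
          ⟪R.comb a, R.vec 1⟫ * ⟪R.vec 1, R.comb a⟫ := by
        rw [← hk, map_sub, hinv, inner_sub_left, inner_sub_right]; ring
      have h4 : ‖⟪ζ, ζ⟫‖ = ‖ζ‖ ^ 2 := by rw [inner_self_eq_norm_sq_to_K]; simp
      have h5 : ‖⟪ζ - R.comb a, ζ⟫‖ ≤ δ * ‖ζ‖ := norm_inner_le_norm _ _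
      have h6 : ‖⟪R.comb a, R.act (k, k) (ζ - R.comb a)⟫‖ ≤ (‖ζ‖ + δ) * δ := by
        refine (norm_inner_le_norm _ _).trans ?_
        rw [R.norm_act]; gcongr
      have h7 : ‖⟪R.comb a, R.vec 1⟫ * ⟪R.vec 1, R.comb a⟫‖ ≤ δ * δ := by
        rw [norm_mul]; gcongr
      rw [← h4, h3]
      refine (norm_add₃_le).trans ?_
      nlinarith
    -- The bound is a closed condition on the approximant, so it may be evaluated at `ζ` itself.
    have h0 := R.dense_comb.induction_on (p := fun b ↦ ‖ζ‖ ^ 2 ≤ 2 * ‖ζ - b‖ * (‖ζ‖ + ‖ζ - b‖)) ζ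
      (isClosed_le (by fun_prop) (by fun_prop)) key
    have hζ0 : ζ = 0 := by
      rw [sub_self, norm_zero, mul_zero, zero_mul] at h0
      have : ‖ζ‖ = 0 := by nlinarith [norm_nonneg ζ]
      simpa using this
    rw [← sub_eq_zero]
    exact eq_zero_of_apply_vec_one (R := R)
      (sub_mem hz (VonNeumannAlgebra.smul_mem _ (one_mem _))) (by rw [← hζ0, hζ]; rfl)

/-- Right translations commute with `p`, and on `ζ = p (vec 1)` left translations by well-chosen
conjugates `x`, `y` nearly agree with right ones. Commutativity of the corner then makes the right
translations by the two orders of the product nearly equal on `ζ`, whereas `noncomm` separates them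
by a multiple of `‖ζ‖`. -/
theorem isTypeIIOne (hχ : IsMixingCharacter χ) : R.vonNeumannAlgebra.IsTypeIIOne where
  finite := isFinite hχ
  eq_zero_of_abelian p hp := by
    obtain ⟨hpM, hproj, hcomm⟩ := hp
    refine eq_zero_of_apply_vec_one hpM ?_
    set ζ := p (R.vec 1) with hζ
    have hpζ : p ζ = ζ := DFunLike.congr_fun hproj.isIdempotentElem (R.vec 1)
    obtain ⟨b, a, hab⟩ := hχ.noncomm
    set s := 1 - (χ (b * a * (a * b)⁻¹)).re with hs
    have hs0 : 0 < s := by rw [hs]; linarith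
    have hpn (ξ : H) : ‖p ξ‖ ≤ ‖ξ‖ := (le_of_opNorm_le _ hproj.norm_le ξ).trans (one_mul _).le
    -- The factor `10` is `4 + 4` from the two products in `hcomp` plus `2` from replacing `ζ` by
    -- the approximant; `2 * s` is the exact squared separation.
    have key (c : Γ →₀ ℂ) : 2 * s * ‖R.comb c‖ ^ 2 ≤ (10 * ‖ζ - R.comb c‖) ^ 2 := by
      classical
      set δ := ‖ζ - R.comb c‖ with hδ
      obtain ⟨k, -, hk⟩ := exists_mixing (R := R) hχ c {a, b, a * b * (b * a)⁻¹}
      set x := k * a * k⁻¹ with hx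
      set y := k * b * k⁻¹ with hy
      have happ {g : Γ} (hg : R.act (g, 1) (R.comb c) = R.act (1, g⁻¹) (R.comb c)) :
          ‖R.act (g, 1) ζ - R.act (1, g⁻¹) ζ‖ ≤ 2 * δ := by
        have : R.act (g, 1) ζ - R.act (1, g⁻¹) ζ =
            R.act (g, 1) (ζ - R.comb c) - R.act (1, g⁻¹) (ζ - R.comb c) := by
          rw [map_sub, map_sub, hg]; abel
        rw [this]
        refine (norm_sub_le _ _).trans ?_
        rw [R.norm_act, R.norm_act]; linarith
      have hcomp {g h : Γ} (hg : R.act (g, 1) (R.comb c) = R.act (1, g⁻¹) (R.comb c))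
          (hh : R.act (h, 1) (R.comb c) = R.act (1, h⁻¹) (R.comb c)) :
          ‖p (R.act (g, 1) (p (R.act (h, 1) ζ))) - R.act (1, h⁻¹ * g⁻¹) ζ‖ ≤ 4 * δ := by
        have e1 : p (R.act (1, h⁻¹) ζ) = R.act (1, h⁻¹) ζ := by rw [apply_act hpM, hpζ]
        have e2 : p (R.act (1, h⁻¹) (R.act (1, g⁻¹) ζ)) = R.act (1, h⁻¹ * g⁻¹) ζ := by
          rw [apply_act hpM, apply_act hpM, hpζ, R.act_apply_act]; simp
        have e3 : R.act (g, 1) (R.act (1, h⁻¹) ζ) = R.act (1, h⁻¹) (R.act (g, 1) ζ) := by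
          rw [R.act_apply_act, R.act_apply_act]; simp
        have e4 : p (R.act (g, 1) (p (R.act (h, 1) ζ))) - R.act (1, h⁻¹ * g⁻¹) ζ =
            p (R.act (g, 1) (p (R.act (h, 1) ζ - R.act (1, h⁻¹) ζ))) +
              p (R.act (1, h⁻¹) (R.act (g, 1) ζ - R.act (1, g⁻¹) ζ)) := by
          rw [map_sub, e1, map_sub, map_sub, e3, map_sub, map_sub, e2]; abel
        rw [e4]
        refine (norm_add_le _ _).trans ?_
        have n1 := (hpn (R.act (g, 1) (p (R.act (h, 1) ζ - R.act (1, h⁻¹) ζ)))).trans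
          ((R.norm_act _ _).le.trans ((hpn _).trans (happ hh)))
        have n2 := (hpn (R.act (1, h⁻¹) (R.act (g, 1) ζ - R.act (1, g⁻¹) ζ))).trans
          ((R.norm_act _ _).le.trans (happ hg))
        linarith
      have hca := (hk a (by simp)).1
      have hcb := (hk b (by simp)).1
      have hpp : p (R.act (x, 1) (p (R.act (y, 1) ζ))) = p (R.act (y, 1) (p (R.act (x, 1) ζ))) := by
        have h := DFunLike.congr_fun
          (hcomm _ (R.act_left_mem x) _ (R.act_left_mem y)).eq (R.vec 1)
        change p (R.act (x, 1) (p (p (R.act (y, 1) ζ)))) =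
          p (R.act (y, 1) (p (p (R.act (x, 1) ζ)))) at h
        have hpp' (ξ : H) : p (p ξ) = p ξ := DFunLike.congr_fun hproj.isIdempotentElem ξ
        rwa [hpp', hpp'] at h
      have d1 : ‖R.act (1, y⁻¹ * x⁻¹) ζ - R.act (1, x⁻¹ * y⁻¹) ζ‖ ≤ 8 * δ := by
        have e : R.act (1, y⁻¹ * x⁻¹) ζ - R.act (1, x⁻¹ * y⁻¹) ζ =
            (p (R.act (y, 1) (p (R.act (x, 1) ζ))) - R.act (1, x⁻¹ * y⁻¹) ζ) -
              (p (R.act (x, 1) (p (R.act (y, 1) ζ))) - R.act (1, y⁻¹ * x⁻¹) ζ) := by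
          rw [hpp]; abel
        rw [e]
        refine (norm_sub_le _ _).trans ?_
        linarith [hcomp hca hcb, hcomp hcb hca]
      have d2 : ‖R.act (1, y⁻¹ * x⁻¹) (R.comb c) - R.act (1, x⁻¹ * y⁻¹) (R.comb c)‖ ≤ 10 * δ := by
        have e : R.act (1, y⁻¹ * x⁻¹) (R.comb c) - R.act (1, x⁻¹ * y⁻¹) (R.comb c) =
            (R.act (1, y⁻¹ * x⁻¹) ζ - R.act (1, x⁻¹ * y⁻¹) ζ) -
              (R.act (1, y⁻¹ * x⁻¹) (ζ - R.comb c) - R.act (1, x⁻¹ * y⁻¹) (ζ - R.comb c)) := by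
          rw [map_sub, map_sub]; abel
        rw [e]
        refine (norm_sub_le _ _).trans ?_
        have := norm_sub_le (R.act (1, y⁻¹ * x⁻¹) (ζ - R.comb c))
          (R.act (1, x⁻¹ * y⁻¹) (ζ - R.comb c))
        rw [R.norm_act, R.norm_act] at this
        linarith
      have hin : ⟪R.act (1, y⁻¹ * x⁻¹) (R.comb c), R.act (1, x⁻¹ * y⁻¹) (R.comb c)⟫ =
          χ (b * a * (a * b)⁻¹) * ⟪R.comb c, R.comb c⟫ := by
        rw [← inner_star_right, R.star_act, R.act_apply_act]
        have h := (hk (a * b * (b * a)⁻¹) (by simp)).2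
        convert h using 4
        · simp only [Prod.inv_mk, Prod.mk_mul_mk, inv_one, mul_one, hx, hy]
          congr 1; group
        · group
      have hnorm : ‖R.act (1, y⁻¹ * x⁻¹) (R.comb c) - R.act (1, x⁻¹ * y⁻¹) (R.comb c)‖ ^ 2 =
          2 * s * ‖R.comb c‖ ^ 2 := by
        rw [@norm_sub_sq ℂ, hin, R.norm_act, R.norm_act, inner_self_eq_norm_sq_to_K]
        have : (χ (b * a * (a * b)⁻¹) * ((‖R.comb c‖ : ℝ) : ℂ) ^ 2).re =
            (χ (b * a * (a * b)⁻¹)).re * ‖R.comb c‖ ^ 2 := by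
          rw [← Complex.ofReal_pow, Complex.re_mul_ofReal]
        change _ - 2 * (χ (b * a * (a * b)⁻¹) * ((‖R.comb c‖ : ℝ) : ℂ) ^ 2).re + _ = _
        rw [this, hs]; ring
      rw [← hnorm]
      gcongr
    have h0 := R.dense_comb.induction_on
      (p := fun b ↦ 2 * s * ‖b‖ ^ 2 ≤ (10 * ‖ζ - b‖) ^ 2) ζ
      (isClosed_le (by fun_prop) (by fun_prop)) key
    rw [sub_self, norm_zero, mul_zero] at h0
    by_contra hne
    have : 0 < ‖ζ‖ ^ 2 := by positivity
    nlinarith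

end CharacterRep

end MixingCharacter

/-! ### The wreath product and its character. -/

section Wreath

variable (U : Type u) [Group U]

/-- The unrestricted wreath product of `U` with the group of permutations of `ℕ`. -/
abbrev WreathProduct : Type u := (ℕ → U) ⋊[mulAutArrow] Equiv.Perm ℕ

variable {U}

namespace WreathProduct

theorem mul_left_apply (g h : WreathProduct U) (n : ℕ) :
    (g * h).left n = g.left n * h.left (g.right⁻¹ n) := rfl

theorem inv_left_apply (g : WreathProduct U) (n : ℕ) : g⁻¹.left n = (g.left (g.right n))⁻¹ := by
  change (g.left ((g.right⁻¹)⁻¹ n))⁻¹ = _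
  rw [inv_inv]

variable (U) in
/-- The elements of the wreath product that only involve the coordinates below `N`. -/
def below (N : ℕ) : Subgroup (WreathProduct U) where
  carrier := {g | ∀ n, N ≤ n → g.left n = 1 ∧ g.right n = n}
  one_mem' _ _ := ⟨rfl, rfl⟩
  mul_mem' {g h} hg hh n hn := by
    have h1 : g.right⁻¹ n = n := by rw [Equiv.Perm.inv_eq_iff_eq, (hg n hn).2]
    refine ⟨by rw [mul_left_apply, h1, (hg n hn).1, (hh n hn).1, one_mul], ?_⟩
    change g.right (h.right n) = n
    rw [(hh n hn).2, (hg n hn).2]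
  inv_mem' {g} hg n hn := by
    refine ⟨by rw [inv_left_apply, (hg n hn).2, (hg n hn).1, inv_one], ?_⟩
    change g.right⁻¹ n = n
    rw [Equiv.Perm.inv_eq_iff_eq, (hg n hn).2]

theorem below_mono {N N' : ℕ} (h : N ≤ N') : below U N ≤ below U N' :=
  fun _ hg n hn ↦ hg n (h.trans hn)

variable (U) in
/-- The restricted wreath product of `U` with the finitary permutations of `ℕ`. -/
def finitary : Subgroup (WreathProduct U) where
  carrier := {g | ∃ N, g ∈ below U N}
  one_mem' := ⟨0, one_mem _⟩
  mul_mem' := by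
    rintro g h ⟨N, hg⟩ ⟨N', hh⟩
    exact ⟨max N N', mul_mem (below_mono (le_max_left _ _) hg) (below_mono (le_max_right _ _) hh)⟩
  inv_mem' := by rintro g ⟨N, hg⟩; exact ⟨N, inv_mem hg⟩

theorem exists_forall_mem_below (F : Finset (finitary U)) :
    ∃ N, ∀ g ∈ F, (g : WreathProduct U) ∈ below U N := by
  choose N hN using fun g : finitary U ↦ g.2
  exact ⟨F.sup N, fun g hg ↦ below_mono (Finset.le_sup hg) (hN g)⟩

open scoped Classical in
/-- The character of the wreath product induced by a class function `t` on `U`: a product over the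
coordinates, extended by zero off the base group. -/
noncomputable def character (t : U → ℂ) (g : WreathProduct U) : ℂ :=
  if g.right = 1 then ∏ᶠ n, t (g.left n) else 0

variable {t : U → ℂ}

theorem character_of_right_eq_one {g : WreathProduct U} (hg : g.right = 1) :
    character t g = ∏ᶠ n, t (g.left n) := if_pos hg

theorem character_of_right_ne_one {g : WreathProduct U} (hg : g.right ≠ 1) :
    character t g = 0 := if_neg hg

theorem character_one (h1 : t 1 = 1) : character t (1 : WreathProduct U) = 1 := by
  rw [character_of_right_eq_one rfl]
  simp [h1]

/-- Conjugation conjugates each coordinate and permutes the coordinates, which a reindexing of the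
product absorbs. -/
theorem character_conj (ht : ∀ k g, t (k * g * k⁻¹) = t g) (k g : WreathProduct U) :
    character t (k * g * k⁻¹) = character t g := by
  by_cases hg : g.right = 1
  · have hr : (k * g * k⁻¹).right = 1 := by simp [hg]
    rw [character_of_right_eq_one hg, character_of_right_eq_one hr,
      ← finprod_comp_equiv k.right⁻¹ (f := fun n ↦ t (g.left n))]
    refine finprod_congr fun n ↦ ?_
    rw [mul_left_apply, mul_left_apply, inv_left_apply]
    have h2 : k.right ((k * g).right⁻¹ n) = n := by simp [hg]
    rw [h2, ht]
  · have hr : (k * g * k⁻¹).right ≠ 1 := by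
      intro h
      apply hg
      simpa using h
    rw [character_of_right_ne_one hg, character_of_right_ne_one hr]

theorem finprod_eq_prod_range (h1 : t 1 = 1) {f : ℕ → U} {N : ℕ} (hf : ∀ n, N ≤ n → f n = 1) :
    ∏ᶠ n, t (f n) = ∏ n ∈ Finset.range N, t (f n) := by
  refine finprod_eq_prod_of_mulSupport_subset _ fun n hn ↦ ?_
  rw [Finset.coe_range, Set.mem_Iio]
  by_contra! hle
  exact hn (by simp only [hf n hle, h1])

open scoped Classical in
-- Reindexing by `g.right` exhibits the kernel as a product of positive semidefinite kernels, ready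
-- for the Schur product theorem.
theorem character_inv_mul (h1 : t 1 = 1) {N : ℕ} {g h : WreathProduct U} (hg : g ∈ below U N)
    (hh : h ∈ below U N) : character t (g⁻¹ * h) =
      (if g.right = h.right then 1 else 0) *
        ∏ n ∈ Finset.range N, t ((g.left n)⁻¹ * h.left n) := by
  by_cases hgh : g.right = h.right
  · rw [if_pos hgh, one_mul, character_of_right_eq_one (by simp [hgh])]
    rw [← finprod_eq_prod_range h1 (f := fun n ↦ (g.left n)⁻¹ * h.left n)
      fun n hn ↦ by rw [(hg n hn).1, (hh n hn).1, inv_one, one_mul]]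
    rw [← finprod_comp_equiv g.right (f := fun n ↦ t ((g.left n)⁻¹ * h.left n))]
    refine finprod_congr fun n ↦ ?_
    rw [mul_left_apply, inv_left_apply]
    simp
  · rw [if_neg hgh, zero_mul, character_of_right_ne_one]
    intro h2
    apply hgh
    have : g.right⁻¹ * h.right = 1 := h2
    exact (inv_mul_eq_one.1 this)

theorem posSemidef_ite {X Y : Type*} [DecidableEq Y] (f : X → Y) :
    (Matrix.of fun x y ↦ if f x = f y then 1 else 0 : Matrix X X ℂ).PosSemidef := by
  have h : (1 : Matrix Y Y ℂ).PosSemidef := Matrix.PosSemidef.one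
  exact h.submatrix f

theorem posSemidef_prod {X : Type*} (k : ℕ → Matrix X X ℂ) (hk : ∀ n, (k n).PosSemidef) (N : ℕ) :
    (Matrix.of fun x y ↦ ∏ n ∈ Finset.range N, k n x y).PosSemidef := by
  induction N with
  | zero =>
    have := posSemidef_ite (X := X) (fun _ ↦ ())
    simpa using this
  | succ N ih =>
    simp_rw [Finset.prod_range_succ]
    exact ih.hadamard (hk N)

/-- A finitely supported vector lives in `below U N` for some `N`, where the kernel is the Schur
product `K N`. -/
theorem posSemidef_character (h1 : t 1 = 1)
    (ht : (Matrix.of fun g h ↦ t (g⁻¹ * h) : Matrix U U ℂ).PosSemidef) :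
    (Matrix.of fun g h : finitary U ↦ character t (g⁻¹ * h : finitary U)).PosSemidef := by
  classical
  let K (N : ℕ) : Matrix (finitary U) (finitary U) ℂ := Matrix.of fun g h ↦
    (if (g : WreathProduct U).right = (h : WreathProduct U).right then 1 else 0) *
      ∏ n ∈ Finset.range N, t (((g : WreathProduct U).left n)⁻¹ * (h : WreathProduct U).left n)
  have hK (N : ℕ) : (K N).PosSemidef :=
    (posSemidef_ite fun g : finitary U ↦ (g : WreathProduct U).right).hadamard
      (posSemidef_prod (fun n ↦ Matrix.of fun g h : finitary U ↦
        t (((g : WreathProduct U).left n)⁻¹ * (h : WreathProduct U).left n))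
        (fun n ↦ ht.submatrix fun g : finitary U ↦ (g : WreathProduct U).left n) N)
  have heq (N : ℕ) (g h : finitary U) (hg : (g : WreathProduct U) ∈ below U N)
      (hh : (h : WreathProduct U) ∈ below U N) :
      character t (g⁻¹ * h : finitary U) = K N g h := character_inv_mul h1 hg hh
  refine ⟨?_, fun x ↦ ?_⟩
  · ext g h
    obtain ⟨N, hN⟩ := exists_forall_mem_below {g, h}
    rw [Matrix.conjTranspose_apply, Matrix.of_apply, Matrix.of_apply,
      heq N h g (hN h (by simp)) (hN g (by simp)), heq N g h (hN g (by simp)) (hN h (by simp))]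
    exact (hK N).1.apply g h
  · obtain ⟨N, hN⟩ := exists_forall_mem_below x.support
    have := (hK N).2 x
    convert this using 1
    refine Finset.sum_congr rfl fun g hg ↦ Finset.sum_congr rfl fun h hh ↦ ?_
    dsimp only
    rw [Matrix.of_apply, heq N g h (hN g hg) (hN h hh)]

/-- The permutation of `ℕ` exchanging the first two blocks of length `N`. -/
def blockSwap (N : ℕ) : Equiv.Perm ℕ :=
  Function.Involutive.toPerm (fun n ↦ if n < N then n + N else if n < 2 * N then n - N else n)
    fun n ↦ by dsimp only; split_ifs <;> omega

theorem blockSwap_apply (N n : ℕ) :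
    blockSwap N n = if n < N then n + N else if n < 2 * N then n - N else n := rfl

theorem blockSwap_inv (N : ℕ) : (blockSwap N)⁻¹ = blockSwap N := rfl

variable (U) in
/-- The block swap as an element of the wreath product. -/
def swap (N : ℕ) : WreathProduct U := ⟨1, blockSwap N⟩

theorem swap_mem (N : ℕ) : swap U N ∈ below U (2 * N) := fun n hn ↦ by
  refine ⟨rfl, ?_⟩
  change blockSwap N n = n
  rw [blockSwap_apply, if_neg (by omega), if_neg (by omega)]

theorem conj_left_apply (N : ℕ) (g : WreathProduct U) (n : ℕ) :
    (swap U N * g * (swap U N)⁻¹).left n = g.left (blockSwap N n) := by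
  rw [mul_left_apply, mul_left_apply, inv_left_apply]
  change 1 * g.left ((blockSwap N)⁻¹ n) * 1⁻¹ = _
  rw [blockSwap_inv, one_mul, inv_one, mul_one]

theorem conj_right_apply (N : ℕ) (g : WreathProduct U) (n : ℕ) :
    (swap U N * g * (swap U N)⁻¹).right n = blockSwap N (g.right (blockSwap N n)) := rfl

theorem right_lt {N : ℕ} {g : WreathProduct U} (hg : g ∈ below U N) {n : ℕ} (hn : n < N) :
    g.right n < N := by
  by_contra! hle
  have := (hg _ hle).2
  exact absurd (g.right.injective this) (by omega)

/-- The swap moves `g` off the first `N` coordinates, the only ones that `h` involves. -/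
theorem commute_conj {N : ℕ} {g h : WreathProduct U} (hg : g ∈ below U N) (hh : h ∈ below U N) :
    Commute h (swap U N * g * (swap U N)⁻¹) := by
  set k := swap U N * g * (swap U N)⁻¹ with hk
  have hkl (n) (hn : n < N) : k.left n = 1 := by
    rw [hk, conj_left_apply, blockSwap_apply, if_pos hn, (hg _ (by omega)).1]
  have hkr (n) (hn : n < N) : k.right n = n := by
    rw [hk, conj_right_apply, blockSwap_apply N n, if_pos hn, (hg _ (by omega)).2, blockSwap_apply,
      if_neg (by omega), if_pos (by omega)]
    omega
  have hkr' (n) (hn : N ≤ n) : N ≤ k.right n := by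
    by_contra! hlt
    have := hkr _ hlt
    exact absurd (k.right.injective this) (by omega)
  have hh' : ∀ n, N ≤ n → h.right⁻¹ n = n := fun n hn ↦ by
    rw [Equiv.Perm.inv_eq_iff_eq, (hh n hn).2]
  have hk' : ∀ n, n < N → k.right⁻¹ n = n := fun n hn ↦ by
    rw [Equiv.Perm.inv_eq_iff_eq, hkr n hn]
  have hinv (n) (hn : n < N) : h.right⁻¹ n < N := right_lt (inv_mem hh) hn
  have hkinv (n) (hn : N ≤ n) : N ≤ k.right⁻¹ n := by
    by_contra! hlt
    have h1 := hkr _ hlt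
    have h2 : k.right (k.right⁻¹ n) = n := k.right.apply_symm_apply n
    omega
  clear_value k
  refine SemidirectProduct.ext (funext fun n ↦ ?_) (Equiv.ext fun n ↦ ?_)
  · rw [mul_left_apply, mul_left_apply]
    rcases lt_or_ge n N with hn | hn
    · rw [hkl _ (hinv n hn), hkl n hn, hk' n hn, mul_one, one_mul]
    · rw [(hh n hn).1, hh' n hn, (hh _ (hkinv n hn)).1, mul_one, one_mul]
  · change h.right (k.right n) = k.right (h.right n)
    rcases lt_or_ge n N with hn | hn
    · rw [hkr n hn, hkr _ (right_lt hh hn)]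
    · rw [(hh n hn).2, (hh _ (hkr' n hn)).2]

/-- On the base group the product splits over the two disjoint blocks. If either permutation is
nontrivial, so is that of the product, and both sides vanish. -/
theorem character_mul_conj (h1 : t 1 = 1) {N : ℕ} {g h : WreathProduct U} (hg : g ∈ below U N)
    (hh : h ∈ below U N) : character t (h * (swap U N * g * (swap U N)⁻¹)) =
      character t h * character t g := by
  set k := swap U N * g * (swap U N)⁻¹ with hk
  have hkl (n) (hn : n < N) : k.left n = 1 := by
    rw [hk, conj_left_apply, blockSwap_apply, if_pos hn, (hg _ (by omega)).1]
  have hkr (n) (hn : n < N) : k.right n = n := by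
    rw [hk, conj_right_apply, blockSwap_apply N n, if_pos hn, (hg _ (by omega)).2, blockSwap_apply,
      if_neg (by omega), if_pos (by omega)]
    omega
  by_cases hr : h.right = 1
  · by_cases gr : g.right = 1
    · have hkr1 : k.right = 1 := by simp [hk, gr]
      rw [character_of_right_eq_one (show (h * k).right = 1 by simp [hr, hkr1]),
        character_of_right_eq_one hr, character_of_right_eq_one gr,
        finprod_eq_prod_range h1 fun n hn ↦ (hh n hn).1,
        finprod_eq_prod_range h1 fun n hn ↦ (hg n hn).1,
        finprod_eq_prod_range h1 (N := N + N) fun n hn ↦ ?_, Finset.prod_range_add]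
      · congr 1
        · refine Finset.prod_congr rfl fun n hn ↦ ?_
          rw [Finset.mem_range] at hn
          rw [mul_left_apply, hr, inv_one, Equiv.Perm.one_apply, hkl n hn, mul_one]
        · refine Finset.prod_congr rfl fun n hn ↦ ?_
          rw [Finset.mem_range] at hn
          rw [mul_left_apply, hr, inv_one, Equiv.Perm.one_apply, (hh _ (by omega)).1, one_mul, hk,
            conj_left_apply, blockSwap_apply, if_neg (by omega), if_pos (by omega),
            Nat.add_sub_cancel_left]
      · rw [mul_left_apply, hr, inv_one, Equiv.Perm.one_apply, (hh _ (by omega)).1, one_mul, hk,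
            conj_left_apply, blockSwap_apply, if_neg (by omega), if_neg (by omega),
            (hg n (by omega)).1]
    · rw [character_of_right_ne_one gr, mul_zero, character_of_right_ne_one]
      intro hcon
      apply gr
      have : k.right = 1 := by simpa [hr] using hcon
      have h3 : (swap U N).right * g.right * (swap U N).right⁻¹ = 1 := this
      simpa using h3
  · rw [character_of_right_ne_one hr, zero_mul, character_of_right_ne_one]
    intro hcon
    apply hr
    ext n
    rcases lt_or_ge n N with hn | hn
    · have : (h * k).right n = n := by rw [hcon]; rfl
      change h.right (k.right n) = n at this
      rw [hkr n hn] at this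
      exact this
    · exact (hh n hn).2

/-- A permutation of the first three coordinates as an element of the wreath product. -/
theorem mk_swap_mem (i j : ℕ) (hi : i < 3) (hj : j < 3) :
    (⟨1, Equiv.swap i j⟩ : WreathProduct U) ∈ below U 3 := fun n hn ↦
  ⟨rfl, Equiv.swap_apply_of_ne_of_ne (by omega) (by omega)⟩

theorem isMixingCharacter (h1 : t 1 = 1) (ht : ∀ k g, t (k * g * k⁻¹) = t g) :
    IsMixingCharacter fun g : finitary U ↦ character t (g : WreathProduct U) where
  one := character_one h1
  conj k g := character_conj ht k g
  mixing F := by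
    obtain ⟨N, hN⟩ := exists_forall_mem_below F
    refine ⟨⟨swap U N, 2 * N, swap_mem N⟩, fun g hg h hh ↦ ⟨?_, ?_⟩⟩
    · exact Subtype.ext (commute_conj (hN g hg) (hN h hh)).eq
    · exact character_mul_conj h1 (hN g hg) (hN h hh)
  noncomm := by
    -- Two noncommuting transpositions: their commutator is off the base group, so the character is
    -- `0` there.
    refine ⟨⟨⟨1, Equiv.swap 0 1⟩, 3, mk_swap_mem 0 1 (by omega) (by omega)⟩,
      ⟨⟨1, Equiv.swap 1 2⟩, 3, mk_swap_mem 1 2 (by omega) (by omega)⟩, ?_⟩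
    rw [character_of_right_ne_one]
    · simp
    · intro hcon
      have h2 : (Equiv.swap 0 1 * Equiv.swap 1 2 * (Equiv.swap 1 2 * Equiv.swap 0 1)⁻¹ :
        Equiv.Perm ℕ) = 1 := hcon
      have h3 := DFunLike.congr_fun (mul_inv_eq_one.1 h2) 0
      revert h3
      decide

variable (U) in
/-- The embedding of `U` as the zeroth coordinate. -/
def single : U →* finitary U :=
  (SemidirectProduct.inl.comp (MonoidHom.mulSingle (fun _ : ℕ ↦ U) 0)).codRestrict (finitary U)
    fun u ↦ ⟨1, fun n hn ↦ ⟨Pi.mulSingle_eq_of_ne (M := fun _ : ℕ ↦ U) (by omega) u, rfl⟩⟩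

theorem character_single (h1 : t 1 = 1) (u : U) :
    character t (single U u : WreathProduct U) = t u := by
  rw [character_of_right_eq_one (show (single U u : WreathProduct U).right = 1 from rfl),
    finprod_eq_prod_range h1 (N := 1) fun n hn ↦ ?_]
  · rw [Finset.prod_range_one]
    exact congrArg t (Pi.mulSingle_eq_same (M := fun _ : ℕ ↦ U) 0 u)
  · exact Pi.mulSingle_eq_of_ne (M := fun _ : ℕ ↦ U) (by omega) u

end WreathProduct

end Wreath

/-! ### Tracial states, unitaries, and the embedding. -/

theorem AlgHom.exists_factor_of_surjective {R A B C : Type*} [CommSemiring R] [Ring A] [Ring B]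
    [Ring C] [Algebra R A] [Algebra R B] [Algebra R C] {f : A →ₐ[R] B} (hf : Function.Surjective f)
    {g : A →ₐ[R] C} (h : ∀ x, f x = 0 → g x = 0) : ∃ k : B →ₐ[R] C, ∀ x, k (f x) = g x := by
  obtain ⟨s, hs⟩ := hf.hasRightInverse
  have key (x y) (hxy : f x = f y) : g x = g y := by
    rw [← sub_eq_zero, ← map_sub]
    exact h _ (by rw [map_sub, hxy, sub_self])
  refine ⟨AlgHom.ofLinearMap ⟨⟨fun b ↦ g (s b), fun a b ↦ ?_⟩, fun r b ↦ ?_⟩ ?_ fun a b ↦ ?_,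
    fun x ↦ key _ _ (hs _)⟩
  · rw [← map_add]
    exact key _ _ (by rw [map_add, hs, hs, hs])
  · rw [RingHom.id_apply, ← map_smul]
    exact key _ _ (by rw [map_smul, hs, hs])
  · exact (key _ 1 (by rw [hs, map_one])).trans (map_one g)
  · exact (key _ (s a * s b) (by rw [map_mul, hs, hs, hs])).trans (map_mul g _ _)

section Tracial

variable {A : Type*} [CStarAlgebra A] {τ : A →L[ℂ] ℂ}

/-- A unital C⋆-algebra is the linear span of the elements `x⋆ x`. -/
theorem CStarAlgebra.induction_star_mul_self {p : A → Prop} (h : ∀ x, p (star x * x))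
    (hadd : ∀ x y, p x → p y → p (x + y)) (hsmul : ∀ (c : ℂ) x, p x → p (c • x)) (a : A) : p a := by
  let _ := CStarAlgebra.spectralOrder A
  let _ := CStarAlgebra.spectralOrderedRing A
  have ha : a ∈ Submodule.span ℂ {a : A | 0 ≤ a} := by
    rw [CStarAlgebra.span_nonneg]; trivial
  induction ha using Submodule.span_induction with
  | mem x hx =>
    obtain ⟨y, rfl⟩ := CStarAlgebra.nonneg_iff_eq_star_mul_self.1 (Set.mem_ofPred.1 hx)
    exact h y
  | zero => simpa using h 0
  | add x y _ _ hx hy => exact hadd x y hx hy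
  | smul c x _ hx => exact hsmul c x hx

theorem IsTracialState.map_star (hτ : IsTracialState τ) (a : A) : τ (star a) = star (τ a) := by
  induction a using CStarAlgebra.induction_star_mul_self with
  | h x =>
    rw [star_mul, star_star]
    exact (IsSelfAdjoint.of_nonneg (hτ.nonneg x)).star_eq.symm
  | hadd x y hx hy => simp only [star_add, map_add, hx, hy]
  | hsmul c x hx => simp only [star_smul, map_smul, hx, smul_eq_mul, star_mul']

/-- For `a = x⋆x` the conjugate is `y⋆y` with `y = x u⋆`, and `y y⋆ = x x⋆`; the elements `x⋆x`
span. -/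
theorem IsTracialState.conj_unitary (hτ : IsTracialState τ) (u : unitary A) (a : A) :
    τ (u * a * star (u : A)) = τ a := by
  induction a using CStarAlgebra.induction_star_mul_self with
  | h x =>
    have h1 : (u : A) * (star x * x) * star (u : A) =
        star (x * star (u : A)) * (x * star (u : A)) := by
      simp only [star_mul, star_star, mul_assoc]
    have h2 : x * star (u : A) * star (x * star (u : A)) = x * star x := by
      rw [star_mul, star_star, mul_assoc, ← mul_assoc (star (u : A)),
        Unitary.star_mul_self_of_mem u.2, one_mul]
    rw [h1, hτ.trace, h2, hτ.trace]
  | hadd x y hx hy => rw [mul_add, add_mul, map_add, map_add, hx, hy]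
  | hsmul c x hx => rw [mul_smul_comm, smul_mul_assoc, map_smul, map_smul, hx]

/-- Serves twice: for positivity of the kernel on unitaries, and for the norm comparison behind the
embedding. -/
theorem apply_star_mul_sum_unitary (x : unitary A →₀ ℂ) :
    τ (star (x.sum fun u c ↦ c • (u : A)) * x.sum fun u c ↦ c • (u : A)) =
      x.sum fun u c ↦ x.sum fun v d ↦ star c * τ ((u⁻¹ * v : unitary A) : A) * d := by
  simp only [Finsupp.sum, star_sum, Finset.sum_mul_sum, map_sum]
  refine Finset.sum_congr rfl fun u _ ↦ Finset.sum_congr rfl fun v _ ↦ ?_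
  rw [star_smul, smul_mul_smul_comm, map_smul, smul_eq_mul, mul_right_comm]
  rfl

theorem IsTracialState.posSemidef (hτ : IsTracialState τ) :
    (Matrix.of fun u v : unitary A ↦ τ ((u⁻¹ * v : unitary A) : A)).PosSemidef := by
  refine ⟨?_, fun x ↦ ?_⟩
  · ext u v
    rw [Matrix.conjTranspose_apply, Matrix.of_apply, Matrix.of_apply, ← hτ.map_star,
      ← Unitary.coe_star, Unitary.star_eq_inv, mul_inv_rev, inv_inv]
  · simp only [Matrix.of_apply]
    rw [← apply_star_mul_sum_unitary]
    exact hτ.nonneg _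

/-- A unital C⋆-algebra is a quotient of the group algebra of its unitary group. -/
theorem CStarAlgebra.lift_unitary_surjective :
    Function.Surjective (MonoidAlgebra.lift ℂ A (unitary A) (unitary A).subtype) := by
  rw [← AlgHom.range_eq_top, ← Algebra.toSubmodule_eq_top, eq_top_iff, ← CStarAlgebra.span_unitary,
    Submodule.span_le]
  intro u hu
  exact ⟨MonoidAlgebra.of ℂ _ ⟨u, hu⟩, MonoidAlgebra.lift_of _ _⟩

variable {Γ : Type*} [Group Γ] {χ : Γ → ℂ} {H : Type*} [NormedAddCommGroup H]
    [InnerProductSpace ℂ H] [CompleteSpace H]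

/-- If a character restricts to a faithful tracial state on a copy of the unitary group of `A`,
then `A` embeds into the von Neumann algebra of the character. -/
theorem CharacterRep.exists_injective_starAlgHom (R : CharacterRep Γ χ H)
    (hf : IsFaithfulFunctional τ) (j : unitary A →* Γ) (hj : ∀ u, χ (j u) = τ (u : A)) :
    ∃ φ : A →⋆ₐ[ℂ] R.vonNeumannAlgebra.toStarSubalgebra, Function.Injective φ := by
  let π : unitary A →* R.vonNeumannAlgebra.toStarSubalgebra :=
    (R.act.comp ((MonoidHom.inl Γ Γ).comp j)).codRestrict R.vonNeumannAlgebra.toStarSubalgebra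
      fun u ↦ R.act_left_mem (j u)
  let P := MonoidAlgebra.lift ℂ A (unitary A) (unitary A).subtype
  let Q := MonoidAlgebra.lift ℂ _ (unitary A) π
  have hQvec (x) : (Q x : H →L[ℂ] H) (R.vec 1) = x.coeff.sum fun u c ↦ c • R.vec (j u) := by
    simp only [Q, MonoidAlgebra.lift_apply, Finsupp.sum, AddSubmonoidClass.coe_finsetSum,
      _root_.sum_apply]
    refine Finset.sum_congr rfl fun u _ ↦ ?_
    change x.coeff u • R.act (j u, 1) (R.vec 1) = _
    rw [R.act_vec, mul_one, inv_one, mul_one]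
  -- This identity makes the kernels of `P` and `Q` coincide: `P x = 0` gives `Q x = 0` since `vec
  -- 1` is separating, and the converse is faithfulness of `τ`.
  have hnorm (x) : inner ℂ ((Q x : H →L[ℂ] H) (R.vec 1)) ((Q x : H →L[ℂ] H) (R.vec 1)) =
      τ (star (P x) * P x) := by
    have hP : P x = x.coeff.sum fun u c ↦ c • (u : A) := MonoidAlgebra.lift_apply _ _
    rw [hP, apply_star_mul_sum_unitary, hQvec]
    simp only [Finsupp.sum, sum_inner, inner_sum, inner_smul_left, inner_smul_right, R.inner_vec,
      Finset.mul_sum]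
    rw [Finset.sum_comm]
    refine Finset.sum_congr rfl fun u _ ↦ Finset.sum_congr rfl fun v _ ↦ ?_
    rw [← map_inv, ← map_mul, hj, RCLike.star_def]
    ring
  have hPQ (x) (hx : P x = 0) : Q x = 0 := by
    refine Subtype.ext (R.eq_zero_of_apply_vec_one (Q x).2 ?_)
    rw [← inner_self_eq_zero (𝕜 := ℂ), hnorm, hx, mul_zero, map_zero]
  have hQP (x) (hx : Q x = 0) : P x = 0 := by
    refine hf _ ?_
    rw [← hnorm, hx]
    simp
  obtain ⟨φ, hφ⟩ := AlgHom.exists_factor_of_surjective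
    (CStarAlgebra.lift_unitary_surjective (A := A)) hPQ
  have hφu (u : unitary A) : φ (u : A) = π u := by
    have := hφ (MonoidAlgebra.of ℂ _ u)
    rwa [MonoidAlgebra.lift_of, MonoidAlgebra.lift_of] at this
  have hstar (a : A) : φ (star a) = star (φ a) := by
    have ha : a ∈ Submodule.span ℂ (unitary A : Set A) := by
      rw [CStarAlgebra.span_unitary]; trivial
    induction ha using Submodule.span_induction with
    | mem u hu =>
      lift u to unitary A using hu
      rw [← Unitary.coe_star, hφu, hφu]
      refine Subtype.ext ?_
      change R.act (j (star u), 1) = star (R.act (j u, 1))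
      rw [R.star_act, Unitary.star_eq_inv, map_inv, Prod.inv_mk, inv_one]
    | zero => simp
    | add x y _ _ hx hy => simp only [star_add, map_add, hx, hy]
    | smul c x _ hx => simp only [star_smul, map_smul, hx]
  refine ⟨⟨φ, hstar⟩, (injective_iff_map_eq_zero φ).2 fun a ha ↦ ?_⟩
  obtain ⟨x, rfl⟩ := CStarAlgebra.lift_unitary_surjective a
  exact hQP x ((hφ x).symm.trans ha)

end Tracial

theorem WreathProduct.exists_characterRep {U : Type u} [Group U] {t : U → ℂ} (h1 : t 1 = 1)
    (hpos : (Matrix.of fun g h ↦ t (g⁻¹ * h) : Matrix U U ℂ).PosSemidef)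
    (ht : ∀ k g, t (k * g * k⁻¹) = t g) :
    ∃ (H : Type u) (_ : NormedAddCommGroup H) (_ : InnerProductSpace ℂ H) (_ : CompleteSpace H),
      Nonempty (CharacterRep (finitary U) (fun g ↦ character t (g : WreathProduct U)) H) :=
  _root_.exists_characterRep (χ := fun g : finitary U ↦ character t (g : WreathProduct U))
    (posSemidef_character h1 hpos) (isMixingCharacter h1 ht).conj

theorem mainTheorem8 (A : Type u) [CStarAlgebra A] :
    (∃ τ : A →L[ℂ] ℂ, IsTracialState τ ∧ IsFaithfulFunctional τ) ↔
      ∃ (H : Type u) (_ : NormedAddCommGroup H) (_ : InnerProductSpace ℂ H) (_ : CompleteSpace H)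
        (M : VonNeumannAlgebra H),
        M.IsFactor ∧ M.IsTypeIIOne ∧
          ∃ φ : A →⋆ₐ[ℂ] M.toStarSubalgebra, Function.Injective φ := by
  constructor
  · rintro ⟨τ, hτ, hf⟩
    let t : unitary A → ℂ := fun u ↦ τ (u : A)
    have h1 : t 1 = 1 := hτ.map_one
    have ht (k g) : t (k * g * k⁻¹) = t g := hτ.conj_unitary k g
    have hχ := WreathProduct.isMixingCharacter h1 ht
    obtain ⟨H, _, _, _, ⟨R⟩⟩ := WreathProduct.exists_characterRep h1 hτ.posSemidef ht
    exact ⟨H, _, _, _, R.vonNeumannAlgebra, CharacterRep.isFactor hχ, CharacterRep.isTypeIIOne hχ,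
      R.exists_injective_starAlgHom hf (WreathProduct.single (unitary A))
        (WreathProduct.character_single h1)⟩
  · rintro ⟨H, _, _, _, M, hM, hII, φ, hφ⟩
    exact exists_faithful_tracialState_of_injective hM hII.finite φ hφ
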